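/- **Lemma (Asymptotic chi-square distribution).** Let $K\ge 2$ (users), $N\ge 0$ (codewords) be fixed integers, let $k\in\{1,\dots,K\}$ be a fixed user (for instance $k=1$), and for every number of antennas $N_t\ge 1$ let $B_{\rm c}=B_{\rm c}(N_t)\ge 0$ be an integer, arbitrarily depending on $N_t$. On one probability space, let the following random vectors of $\mathbb{C}^{N_t}$ be given for every $N_t\ge1$ (with an arbitrary joint dependence between different values of $N_t$). * Channels $\mathbf h_1,\dots,\mathbf h_K$, each with iid $\mathcal{CN}(0,1)$ entries, and channel codebooks $\mathcal C_j^{\rm c}=(\mathbf c_{j,a})_{a=1}^{2^{B_{\rm c}}}$, $1\le j\le K$, whose codewords are unit norm isotropic random vectors (norm $1$ almost surely, law invariant under all unitary transformations). All the vectors $\mathbf h_j$ and $\mathbf c_{j,a}$ are mutually independent. * Quantized channels $\hat{\mathbf h}_j=\|\mathbf h_j\|\,\hat{\mathbf g}_j$, where $\hat{\mathbf g}_j\in\arg\max_{\mathbf u\in\mathcal C_j^{\rm c}}|\mathbf h_j^{\rm H}\mathbf u|$ almost surely, ties being broken in any measurable way. * Independent unit norm isotropic random vectors $\mathbf w_1,\dots,\mathbf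 w_N$ (the precoder codewords), with $(\mathbf w_1,\dots,\mathbf w_N)$ independent of $(\hat{\mathbf h}_1,\dots,\hat{\mathbf h}_K)$. Put $\widetilde Y_i=\sum_{j\ne k}|\hat{\mathbf h}_j^{\rm H}\mathbf w_i|^2$ for $1\le i\le N$, and let $X_1,\dots,X_N$ be iid random variables with the chi-square distribution $\chi^2(2(K-1))$, that is, the distribution of the sum of the squares of $2(K-1)$ independent standard real Gaussians. Then, as $N_t\to\infty$, $$(\widetilde Y_1,\dots,\widetilde Y_N)\xrightarrow{\ \rm d\ }\tfrac12(X_1,\dots,X_N).$$ The same convergence holds given the quantized channels: for almost every realization of the quantized channels $\{\hat{\mathbf h}_j\}$ (for all $N_t$), with this realization held fixed and only the codewords $\mathbf w_i$ random, $(\widetilde Y_1,\dots,\widetilde Y_N)$ converges in distribution to $\frac12(X_1,\dots,X_N)$ as $N_t\to\infty$. -/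

import Mathlib

open MeasureTheory ProbabilityTheory Filter
open scoped NNReal

noncomputable section

/-- The space `ℂ^n` with its Hermitian norm; `inner ℂ x y` is `xᴴ y`. -/
abbrev CVec (n : ℕ) : Type := EuclideanSpace ℂ (Fin n)

/-- The circularly symmetric complex Gaussian law `CN(0,1)`: real and imaginary parts are
independent centred real Gaussians of variance `1/2`. -/
def complexGaussian : Measure ℂ :=
  ((gaussianReal 0 (1 / 2 : ℝ≥0)).prod (gaussianReal 0 (1 / 2 : ℝ≥0))).map
    (fun p : ℝ × ℝ => (⟨p.1, p.2⟩ : ℂ))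

/-- The law `CN(0, I)` on `ℂ^n`: the entries are iid `CN(0,1)`. -/
def complexGaussianVec (n : ℕ) : Measure (CVec n) :=
  (Measure.pi fun _ : Fin n => complexGaussian).map (WithLp.toLp 2)

/-- The chi-square law with `d` degrees of freedom: the law of the sum of the squares of `d`
independent standard real Gaussians. -/
def chiSquare (d : ℕ) : Measure ℝ :=
  (Measure.pi fun _ : Fin d => gaussianReal 0 1).map (fun x => ∑ i, x i ^ 2)

/-- `v` is a unit norm isotropic random vector of `ℂ^n`: it has norm one almost surely and its law
is invariant under every unitary transformation. -/
structure IsIsotropicUnitVector {Ω : Type*} [MeasurableSpace Ω] (P : Measure Ω) {n : ℕ}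
    (v : Ω → CVec n) : Prop where
  aemeasurable : AEMeasurable v P
  norm_eq_one : ∀ᵐ ω ∂P, ‖v ω‖ = 1
  map_unitary : ∀ U : CVec n ≃ₗᵢ[ℂ] CVec n, P.map (fun ω => U (v ω)) = P.map v

/-- `g` is a codeword of the (finite) codebook `c` that maximizes `|hᴴ u|` over the codewords
`u`, i.e. `g ∈ argmax_{u ∈ c} |hᴴ u|`. -/
def IsQuantizedDirection {n : ℕ} {ι : Type*} (h : CVec n) (c : ι → CVec n) (g : CVec n) : Prop :=
  ∃ a, g = c a ∧ ∀ b, ‖inner ℂ h (c b)‖ ≤ ‖inner ℂ h (c a)‖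

/-- The quantized channel `ĥ = ‖h‖ ĝ`. -/
def quantizedChannel {n : ℕ} (h g : CVec n) : CVec n := (‖h‖ : ℂ) • g

/-- The leakage `∑_{j ≠ k} |ĥ_jᴴ w|²` of user `k` with precoding vector `w`. -/
def leakage {n K : ℕ} (k : Fin K) (hhat : Fin K → CVec n) (w : CVec n) : ℝ :=
  ∑ j ∈ Finset.univ.erase k, ‖inner ℂ (hhat j) w‖ ^ 2

end

/-! Fix the quantized channels `ĥ_j`. The vector of products `ĥ_jᴴ w` is a linear image of the
isotropic vector `w`, so its characteristic function at `s` is that of `w` at `∑ s_j ĥ_j`. In large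
dimension `N`, `w` resembles `CN(0, I/N)`: its characteristic function is radial, its average over a
Gaussian point whose norm concentrates at `‖t‖` is exactly the Gaussian value, and a Lipschitz bound
controls its oscillation over such radii (`IsIsotropicLaw.norm_charFun_sub_exp_le`). Hence the
products converge to `CN(0, I)` as soon as the Gram matrix of the `ĥ_j`, divided by `N`, tends to
the identity; the `K - 1` squared moduli kept then sum to half a chi-square (`tendsto_map_leakage`).
Independence of the `w_i` upgrades this to the joint law (`tendstoInDistribution_leakage`).

The Gram condition holds almost surely (`ae_gramTendstoOne_quantizedChannel`). On the diagonal,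
`‖h_j‖²/N → 1`. Off the diagonal, quantization commutes with unitary maps and ties are null once `N
≥ 2`, so the quantized directions are again isotropic, and independent between users, whatever the
codebook size. The relevant fourth moments are `O(N⁻²)`, hence summable, and no assumption on the
dependence between different dimensions is needed.

Convergence for almost every fixed realization gives the unconditional statement by Fubini and
dominated convergence (`tendstoInDistribution_of_ae_fixed`). -/

/-! ### Complex Gaussian laws: characteristic functions, unitary invariance, moments. -/

lemma measurable_complex_mk : Measurable (fun p : ℝ × ℝ => (⟨p.1, p.2⟩ : ℂ)) :=
  Complex.measurableEquivRealProd.symm.measurable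

instance isProbabilityMeasure_complexGaussian : IsProbabilityMeasure complexGaussian :=
  Measure.isProbabilityMeasure_map measurable_complex_mk.aemeasurable

instance isProbabilityMeasure_complexGaussianVec (n : ℕ) :
    IsProbabilityMeasure (complexGaussianVec n) :=
  Measure.isProbabilityMeasure_map (MeasurableEquiv.toLp 2 _).measurable.aemeasurable

instance isProbabilityMeasure_chiSquare (d : ℕ) : IsProbabilityMeasure (chiSquare d) :=
  Measure.isProbabilityMeasure_map (Measurable.aemeasurable (by fun_prop))

lemma norm_sq_complex_mk (p : ℝ × ℝ) : ‖(⟨p.1, p.2⟩ : ℂ)‖ ^ 2 = p.1 ^ 2 + p.2 ^ 2 := by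
  rw [Complex.sq_norm, Complex.normSq_mk, sq, sq]

lemma charFun_complexGaussian (t : ℂ) :
    charFun complexGaussian t = Complex.exp (-(‖t‖ ^ 2 / 4 : ℝ)) := by
  have h : charFun complexGaussian t = charFun (gaussianReal 0 (1 / 2 : ℝ≥0)) t.re *
      charFun (gaussianReal 0 (1 / 2 : ℝ≥0)) t.im := by
    simp only [charFun, complexGaussian]
    rw [integral_map measurable_complex_mk.aemeasurable (by fun_prop), ← integral_prod_mul]
    congr 1 with p
    rw [← Complex.exp_add, ← add_mul]
    simp [Complex.inner, mul_comm]
  rw [h, charFun_gaussianReal, charFun_gaussianReal, ← Complex.exp_add, Complex.sq_norm,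
    Complex.normSq_apply]
  congr 1
  push_cast
  ring

lemma charFun_complexGaussianVec {n : ℕ} (t : CVec n) :
    charFun (complexGaussianVec n) t = Complex.exp (-(‖t‖ ^ 2 / 4 : ℝ)) := by
  rw [complexGaussianVec, charFun_pi, EuclideanSpace.norm_sq_eq]
  simp only [charFun_complexGaussian]
  rw [← Complex.exp_sum]
  congr 1
  push_cast
  rw [Finset.sum_neg_distrib, Finset.sum_div]

lemma inner_linearIsometryEquiv_symm {n : ℕ} (U : CVec n ≃ₗᵢ[ℂ] CVec n) (x t : CVec n) :
    inner ℂ (U x) t = inner ℂ x (U.symm t) := by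
  rw [← U.inner_map_map x, U.apply_symm_apply]

lemma real_inner_cvec {n : ℕ} (x t : CVec n) : inner ℝ x t = (inner ℂ x t).re := by
  simp [PiLp.inner_apply, Complex.inner]

lemma measurable_linearIsometryEquiv {n : ℕ} (U : CVec n ≃ₗᵢ[ℂ] CVec n) : Measurable U :=
  U.continuous.measurable

lemma charFun_map_linearIsometryEquiv {n : ℕ} (μ : Measure (CVec n)) (U : CVec n ≃ₗᵢ[ℂ] CVec n)
    (t : CVec n) : charFun (μ.map U) t = charFun μ (U.symm t) := by
  simp only [charFun]
  rw [integral_map (measurable_linearIsometryEquiv U).aemeasurable (by fun_prop)]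
  simp only [real_inner_cvec, inner_linearIsometryEquiv_symm]

lemma map_linearIsometryEquiv_complexGaussianVec {n : ℕ} (U : CVec n ≃ₗᵢ[ℂ] CVec n) :
    (complexGaussianVec n).map U = complexGaussianVec n := by
  have := Measure.isProbabilityMeasure_map (μ := complexGaussianVec n)
    (measurable_linearIsometryEquiv U).aemeasurable
  refine Measure.ext_of_charFun (funext fun t => ?_)
  rw [charFun_map_linearIsometryEquiv, charFun_complexGaussianVec, charFun_complexGaussianVec,
    U.symm.norm_map]

lemma map_eval_complexGaussianVec {n : ℕ} (i : Fin n) :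
    (complexGaussianVec n).map (fun z => z i) = complexGaussian := by
  rw [complexGaussianVec, Measure.map_map (by fun_prop) (by fun_prop)]
  exact (measurePreserving_eval (fun _ : Fin n => complexGaussian) i).map_eq

lemma integrable_pow_gaussianReal (v : ℝ≥0) (k : ℕ) :
    Integrable (fun x => x ^ k) (gaussianReal 0 v) := by
  have := (memLp_id_gaussianReal (μ := 0) (v := v) k).integrable_norm_pow'
  rw [← integrable_norm_iff (by fun_prop)]
  simpa using this

lemma integral_sq_gaussianReal (v : ℝ≥0) : ∫ x, x ^ 2 ∂gaussianReal 0 v = v := by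
  have := variance_fun_id_gaussianReal (μ := 0) (v := v)
  rwa [variance_of_integral_eq_zero (by fun_prop) (by simp)] at this

lemma integrable_norm_pow_complexGaussian_iff (f : ℝ → ℝ) (hf : Measurable f) :
    Integrable (fun z : ℂ => f (‖z‖ ^ 2)) complexGaussian ↔
      Integrable (fun p : ℝ × ℝ => f (p.1 ^ 2 + p.2 ^ 2))
        ((gaussianReal 0 (1 / 2 : ℝ≥0)).prod (gaussianReal 0 (1 / 2 : ℝ≥0))) := by
  rw [complexGaussian, integrable_map_measure (Measurable.aestronglyMeasurable (by fun_prop))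
    measurable_complex_mk.aemeasurable]
  simp only [Function.comp_def, norm_sq_complex_mk]

lemma integral_norm_sq_comp_complexGaussian (f : ℝ → ℝ) (hf : Measurable f) :
    ∫ z, f (‖z‖ ^ 2) ∂complexGaussian = ∫ p : ℝ × ℝ, f (p.1 ^ 2 + p.2 ^ 2)
        ∂((gaussianReal 0 (1 / 2 : ℝ≥0)).prod (gaussianReal 0 (1 / 2 : ℝ≥0))) := by
  rw [complexGaussian, integral_map measurable_complex_mk.aemeasurable
    (Measurable.aestronglyMeasurable (by fun_prop))]
  simp only [norm_sq_complex_mk]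

lemma integrable_norm_sq_complexGaussian :
    Integrable (fun z : ℂ => ‖z‖ ^ 2) complexGaussian := by
  rw [integrable_norm_pow_complexGaussian_iff (fun x => x) measurable_id]
  exact ((integrable_pow_gaussianReal _ 2).comp_fst _).add
    ((integrable_pow_gaussianReal _ 2).comp_snd _)

lemma integral_norm_sq_complexGaussian : ∫ z : ℂ, ‖z‖ ^ 2 ∂complexGaussian = 1 := by
  rw [integral_norm_sq_comp_complexGaussian (fun x => x) measurable_id,
    integral_add ((integrable_pow_gaussianReal _ 2).comp_fst _)
    ((integrable_pow_gaussianReal _ 2).comp_snd _), integral_fun_fst (fun x : ℝ => x ^ 2),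
    integral_fun_snd (fun x : ℝ => x ^ 2), integral_sq_gaussianReal]
  norm_num

lemma integrable_norm_pow_four_complexGaussian :
    Integrable (fun z : ℂ => ‖z‖ ^ 4) complexGaussian := by
  have := integrable_norm_pow_complexGaussian_iff (fun x => x ^ 2) (by fun_prop)
  simp only [← pow_mul] at this
  refine this.2 ?_
  have h := (((integrable_pow_gaussianReal (1 / 2) 4).comp_fst (gaussianReal 0 (1 / 2))).add
    ((integrable_pow_gaussianReal (1 / 2) 4).comp_snd (gaussianReal 0 (1 / 2)))).const_mul 2
  refine h.mono' (by fun_prop) (ae_of_all _ fun p => ?_)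
  rw [Real.norm_of_nonneg (by positivity)]
  simp only [Pi.add_apply]
  nlinarith [sq_nonneg (p.1 ^ 2 - p.2 ^ 2)]

/-- No condition on `s` is needed: for `s ≥ 1` both sides take the default value `0`. -/
lemma integral_exp_mul_sq_gaussianReal (s : ℝ) :
    ∫ x, Real.exp (s * x ^ 2) ∂gaussianReal 0 (1 / 2 : ℝ≥0) = (√(1 - s))⁻¹ := by
  rw [integral_gaussianReal_eq_integral_smul (by norm_num), gaussianPDFReal_def]
  have : ∀ x : ℝ, ((√(2 * Real.pi * ((1 / 2 : ℝ≥0) : ℝ)))⁻¹ *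
      Real.exp (-(x - 0) ^ 2 / (2 * ((1 / 2 : ℝ≥0) : ℝ)))) • Real.exp (s * x ^ 2) =
      (√Real.pi)⁻¹ * Real.exp (-(1 - s) * x ^ 2) := by
    intro x
    rw [smul_eq_mul, mul_assoc, ← Real.exp_add]
    congr 3
    · norm_num; ring
    · norm_num; ring
  simp_rw [this]
  rw [integral_const_mul, integral_gaussian, Real.sqrt_div Real.pi_nonneg]
  have := Real.sqrt_pos.2 Real.pi_pos
  field_simp

lemma integrable_exp_mul_sq_gaussianReal {s : ℝ} (hs : s < 1) :
    Integrable (fun x => Real.exp (s * x ^ 2)) (gaussianReal 0 (1 / 2 : ℝ≥0)) := by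
  by_contra h
  have h1 := integral_exp_mul_sq_gaussianReal s
  -- A non-integrable function would have integral `0`, but the closed form is positive.
  rw [integral_undef h] at h1
  have : 0 < √(1 - s) := Real.sqrt_pos.2 (by linarith)
  have := inv_pos.2 this
  linarith

lemma integrable_exp_mul_norm_sq_complexGaussian {s : ℝ} (hs : s < 1) :
    Integrable (fun z : ℂ => Real.exp (s * ‖z‖ ^ 2)) complexGaussian := by
  rw [integrable_norm_pow_complexGaussian_iff (fun x => Real.exp (s * x)) (by fun_prop)]
  simp only [mul_add, Real.exp_add]
  exact (integrable_exp_mul_sq_gaussianReal hs).mul_prod (integrable_exp_mul_sq_gaussianReal hs)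

lemma integral_exp_mul_norm_sq_complexGaussian {s : ℝ} (hs : s < 1) :
    ∫ z : ℂ, Real.exp (s * ‖z‖ ^ 2) ∂complexGaussian = (1 - s)⁻¹ := by
  rw [integral_norm_sq_comp_complexGaussian (fun x => Real.exp (s * x)) (by fun_prop)]
  simp only [mul_add, Real.exp_add]
  rw [integral_prod_mul (fun x : ℝ => Real.exp (s * x ^ 2)) (fun x : ℝ => Real.exp (s * x ^ 2)),
    integral_exp_mul_sq_gaussianReal, ← mul_inv, Real.mul_self_sqrt (by linarith)]

lemma integrable_exp_mul_norm_sq_complexGaussianVec (n : ℕ) {s : ℝ} (hs : s < 1) :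
    Integrable (fun z : CVec n => Real.exp (s * ‖z‖ ^ 2)) (complexGaussianVec n) := by
  rw [complexGaussianVec, ← MeasurableEquiv.coe_toLp, integrable_map_equiv]
  simp only [Function.comp_def, MeasurableEquiv.coe_toLp, EuclideanSpace.norm_sq_eq,
    Finset.mul_sum, Real.exp_sum]
  exact Integrable.fintype_prod (f := fun _ (z : ℂ) => Real.exp (s * ‖z‖ ^ 2))
    (fun _ => integrable_exp_mul_norm_sq_complexGaussian hs)

lemma integral_exp_mul_norm_sq_complexGaussianVec (n : ℕ) {s : ℝ} (hs : s < 1) :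
    ∫ z : CVec n, Real.exp (s * ‖z‖ ^ 2) ∂complexGaussianVec n = ((1 - s)⁻¹) ^ n := by
  rw [complexGaussianVec, ← MeasurableEquiv.coe_toLp, integral_map_equiv]
  simp only [MeasurableEquiv.coe_toLp, EuclideanSpace.norm_sq_eq, Finset.mul_sum, Real.exp_sum]
  rw [integral_fintype_prod_eq_pow (fun z : ℂ => Real.exp (s * ‖z‖ ^ 2)),
    integral_exp_mul_norm_sq_complexGaussian hs, Fintype.card_fin]

lemma integrable_norm_sq_complexGaussianVec (n : ℕ) :
    Integrable (fun z : CVec n => ‖z‖ ^ 2) (complexGaussianVec n) := by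
  simp only [EuclideanSpace.norm_sq_eq]
  refine integrable_finsetSum _ fun i _ => ?_
  have := integrable_norm_sq_complexGaussian
  rw [← map_eval_complexGaussianVec i,
    integrable_map_measure (by fun_prop) (by fun_prop)] at this
  exact this

lemma integral_norm_sq_complexGaussianVec (n : ℕ) :
    ∫ z : CVec n, ‖z‖ ^ 2 ∂complexGaussianVec n = n := by
  simp only [EuclideanSpace.norm_sq_eq]
  rw [integral_finsetSum]
  · have : ∀ i : Fin n, ∫ z : CVec n, ‖z i‖ ^ 2 ∂complexGaussianVec n = 1 := fun i => by
      rw [← integral_norm_sq_complexGaussian, ← map_eval_complexGaussianVec i,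
        integral_map (by fun_prop) (by fun_prop)]
    simp [this]
  · intro i _
    have := integrable_norm_sq_complexGaussian
    rw [← map_eval_complexGaussianVec i,
      integrable_map_measure (by fun_prop) (by fun_prop)] at this
    exact this

lemma complexGaussian_sphere (r : ℝ) : complexGaussian (Metric.sphere 0 r) = 0 := by
  have hac : complexGaussian ≪ volume := by
    have h1 := gaussianReal_absolutelyContinuous 0 (v := 1 / 2) (by norm_num)
    have h2 := (h1.prod h1).map measurable_complex_mk
    rwa [← Measure.volume_eq_prod,
      show (volume : Measure (ℝ × ℝ)).map (fun p : ℝ × ℝ => (⟨p.1, p.2⟩ : ℂ)) = volume from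
        Complex.volume_preserving_equiv_real_prod.symm.map_eq] at h2
  exact hac (Measure.addHaar_sphere _ _ _)

/-! ### Isotropic laws on the unit sphere and their comparison with Gaussian vectors. -/

/-- A probability law on `ℂ^n` carried by the unit sphere and invariant under unitary maps. -/
structure IsIsotropicLaw {n : ℕ} (μ : Measure (CVec n)) : Prop where
  norm_eq_one : ∀ᵐ v ∂μ, ‖v‖ = 1
  map_unitary : ∀ U : CVec n ≃ₗᵢ[ℂ] CVec n, μ.map U = μ

lemma IsIsotropicUnitVector.isIsotropicLaw {Ω : Type*} [MeasurableSpace Ω] {P : Measure Ω} {n : ℕ}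
    {v : Ω → CVec n} (hv : IsIsotropicUnitVector P v) : IsIsotropicLaw (P.map v) where
  norm_eq_one := by
    rw [ae_map_iff hv.aemeasurable (measurableSet_eq_fun (by fun_prop) (by fun_prop))]
    exact hv.norm_eq_one
  map_unitary U := by
    rw [AEMeasurable.map_map_of_aemeasurable (measurable_linearIsometryEquiv U).aemeasurable
      hv.aemeasurable]
    exact hv.map_unitary U

/-- The isometry from the line `ℂx` to `ℂy` extends to the whole space, and is onto by finite
dimension. -/
lemma exists_linearIsometryEquiv_apply_eq_of_norm_eq_one {n : ℕ} {x y : CVec n} (hx : ‖x‖ = 1)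
    (hy : ‖y‖ = 1) : ∃ U : CVec n ≃ₗᵢ[ℂ] CVec n, U x = y := by
  let e := LinearIsometryEquiv.toSpanUnitSingleton (𝕜 := ℂ) x hx
  let L := (LinearIsometry.toSpanSingleton ℂ (CVec n) hy).comp e.symm.toLinearIsometry
  refine ⟨L.extend.toLinearIsometryEquiv rfl, ?_⟩
  have h1 : e 1 = ⟨x, Submodule.mem_span_singleton_self x⟩ := by
    simp [e]
  have h2 : L ⟨x, Submodule.mem_span_singleton_self x⟩ = y := by
    simp [L, ← h1]
  exact (L.extend_apply ⟨x, Submodule.mem_span_singleton_self x⟩).trans h2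

lemma exists_linearIsometryEquiv_apply_eq {n : ℕ} {x y : CVec n} (h : ‖x‖ = ‖y‖) :
    ∃ U : CVec n ≃ₗᵢ[ℂ] CVec n, U x = y := by
  by_cases hx : x = 0
  · refine ⟨LinearIsometryEquiv.refl ℂ _, ?_⟩
    subst hx
    have hy : y = 0 := by rwa [norm_zero, eq_comm, norm_eq_zero] at h
    simp [hy]
  · have hx' : ‖x‖ ≠ 0 := norm_ne_zero_iff.2 hx
    have hx1 : ‖((‖x‖⁻¹ : ℝ) : ℂ) • x‖ = 1 := by
      rw [norm_smul, Complex.norm_real, norm_inv, norm_norm, inv_mul_cancel₀ hx']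
    have hy1 : ‖((‖x‖⁻¹ : ℝ) : ℂ) • y‖ = 1 := by
      rw [norm_smul, Complex.norm_real, norm_inv, norm_norm, ← h, inv_mul_cancel₀ hx']
    obtain ⟨U, hU⟩ := exists_linearIsometryEquiv_apply_eq_of_norm_eq_one hx1 hy1
    refine ⟨U, ?_⟩
    rw [map_smul] at hU
    exact smul_right_injective _ (by simpa using hx) hU

lemma lintegral_norm_inner_eq_of_norm_eq {n : ℕ} {μ : Measure (CVec n)}
    (hμ : ∀ U : CVec n ≃ₗᵢ[ℂ] CVec n, μ.map U = μ) {φ : ℝ → ENNReal} (hφ : Measurable φ)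
    {x y : CVec n} (h : ‖x‖ = ‖y‖) :
    ∫⁻ v, φ ‖inner ℂ x v‖ ∂μ = ∫⁻ v, φ ‖inner ℂ y v‖ ∂μ := by
  obtain ⟨U, rfl⟩ := exists_linearIsometryEquiv_apply_eq h
  nth_rw 2 [← hμ U]
  rw [lintegral_map (by fun_prop) (measurable_linearIsometryEquiv U)]
  simp only [LinearIsometryEquiv.inner_map_map]

lemma charFun_eq_of_norm_eq {n : ℕ} {μ : Measure (CVec n)}
    (hμ : ∀ U : CVec n ≃ₗᵢ[ℂ] CVec n, μ.map U = μ) {s t : CVec n} (h : ‖s‖ = ‖t‖) :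
    charFun μ s = charFun μ t := by
  obtain ⟨U, rfl⟩ := exists_linearIsometryEquiv_apply_eq h
  nth_rw 2 [← hμ U]
  rw [charFun_map_linearIsometryEquiv, U.symm_apply_apply]

/-- Averaging a function of `|zᴴ v|` and `‖z‖` over a Gaussian vector `z` and an isotropic unit
vector `v`, the vector `v` may be replaced by a basis vector. -/
lemma lintegral_lintegral_norm_inner {n : ℕ} {μ : Measure (CVec (n + 1))} [IsProbabilityMeasure μ]
    (hμ : IsIsotropicLaw μ) {φ : ℝ × ℝ → ENNReal} (hφ : Measurable φ) :
    ∫⁻ z, ∫⁻ v, φ (‖inner ℂ z v‖, ‖z‖) ∂μ ∂complexGaussianVec (n + 1) =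
      ∫⁻ z : CVec (n + 1), φ (‖z 0‖, ‖z‖) ∂complexGaussianVec (n + 1) := by
  rw [lintegral_lintegral_swap
    (Measurable.aemeasurable (by simp only [Function.uncurry_def]; fun_prop))]
  have key : ∀ v : CVec (n + 1), ‖v‖ = 1 →
      ∫⁻ z, φ (‖inner ℂ z v‖, ‖z‖) ∂complexGaussianVec (n + 1) =
      ∫⁻ z : CVec (n + 1), φ (‖z 0‖, ‖z‖) ∂complexGaussianVec (n + 1) := by
    intro v hv
    have he : ‖(EuclideanSpace.single 0 1 : CVec (n + 1))‖ = 1 := by simp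
    -- Rotate the basis vector to `v` and absorb the rotation in the Gaussian law of `z`.
    obtain ⟨U, hU⟩ := exists_linearIsometryEquiv_apply_eq_of_norm_eq_one he hv
    nth_rw 1 [← map_linearIsometryEquiv_complexGaussianVec U]
    rw [lintegral_map (by fun_prop) (measurable_linearIsometryEquiv U)]
    refine lintegral_congr fun z => ?_
    rw [← hU, U.inner_map_map, U.norm_map, EuclideanSpace.inner_single_right]
    simp
  rw [lintegral_congr_ae (hμ.norm_eq_one.mono key), lintegral_const, measure_univ, mul_one]

lemma measure_eval_complexGaussianVec_eq_zero {n : ℕ} (i : Fin n) :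
    complexGaussianVec n {z | z i = 0} = 0 := by
  have h := complexGaussian_sphere 0
  rw [← map_eval_complexGaussianVec i,
    Measure.map_apply (by fun_prop) Metric.isClosed_sphere.measurableSet] at h
  simpa [Set.preimage] using h

/-- Tonelli, integrating the `i`-th coordinate first. -/
lemma pi_null_of_slices {ι : Type*} [Fintype ι] [DecidableEq ι] {X : ι → Type*}
    [∀ i, MeasurableSpace (X i)] (μ : ∀ i, Measure (X i)) [∀ i, SigmaFinite (μ i)]
    {s : Set (∀ i, X i)} (hs : MeasurableSet s) (i : ι)
    (h : ∀ x, μ i {y | Function.update x i y ∈ s} = 0) : Measure.pi μ s = 0 := by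
  rw [← lintegral_indicator_one hs]
  rcases isEmpty_or_nonempty (∀ i, X i) with he | ⟨⟨x₀⟩⟩
  · simp [Set.eq_empty_of_isEmpty s]
  rw [lintegral_eq_lmarginal_univ x₀,
    lmarginal_erase' _ (measurable_one.indicator hs) (Finset.mem_univ i)]
  have : (fun x => ∫⁻ y, s.indicator 1 (Function.update x i y) ∂μ i) = fun _ => (0 : ENNReal) := by
    funext x
    exact (lintegral_indicator_one (hs.preimage (measurable_update x))).trans (h x)
  rw [this]
  simp [lmarginal]

/-- For `t ≠ 0`, freezing all coordinates except `z 1` forces `z 1` onto a circle, which is null. A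
second coordinate is essential: in dimension one, `t = 1` gives the whole space. -/
lemma complexGaussianVec_norm_eval_eq_null {n : ℕ} (t : ℝ) :
    complexGaussianVec (n + 2) {z | ‖z 0‖ = t * ‖z‖} = 0 := by
  rcases eq_or_ne t 0 with rfl | ht
  · simpa using measure_eval_complexGaussianVec_eq_zero (n := n + 2) 0
  have hm : MeasurableSet {z : CVec (n + 2) | ‖z 0‖ = t * ‖z‖} :=
    measurableSet_eq_fun (by fun_prop) (by fun_prop)
  rw [complexGaussianVec, Measure.map_apply (by fun_prop) hm]
  refine pi_null_of_slices _ (hm.preimage (by fun_prop)) 1 fun x => ?_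
  set r : ℝ := ‖x 0‖ ^ 2 / t ^ 2 - ∑ i ∈ Finset.univ.erase 1, ‖x i‖ ^ 2 with hr
  refine measure_mono_null (fun y hy => ?_) (complexGaussian_sphere (√r))
  simp only [Set.mem_preimage, Set.mem_ofPred_eq] at hy
  have h2 : ‖x 0‖ ^ 2 = t ^ 2 * ∑ i, ‖Function.update x 1 y i‖ ^ 2 := by
    have := congrArg (· ^ 2) hy
    simp only [mul_pow, EuclideanSpace.norm_sq_eq] at this
    rwa [Function.update_of_ne (by simp)] at this
  have h3 : ∑ i ∈ Finset.univ.erase 1, ‖Function.update x 1 y i‖ ^ 2 =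
      ∑ i ∈ Finset.univ.erase 1, ‖x i‖ ^ 2 :=
    Finset.sum_congr rfl fun i hi => by rw [Function.update_of_ne (Finset.ne_of_mem_erase hi)]
  rw [← Finset.add_sum_erase _ _ (Finset.mem_univ 1), Function.update_self, h3] at h2
  have h4 : ‖y‖ ^ 2 = r := by
    rw [hr, h2]
    field_simp
    ring
  rw [mem_sphere_zero_iff_norm, ← h4, Real.sqrt_sq (norm_nonneg y)]

/-- By invariance the event `|zᴴ v| = (t / ‖x‖) ‖z‖` is at least as likely, for every `z`, as the
event in question. Averaged over a Gaussian `z`, it becomes the null event of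
`complexGaussianVec_norm_eval_eq_null`. -/
lemma IsIsotropicLaw.measure_norm_inner_eq_null {n : ℕ} {μ : Measure (CVec (n + 2))}
    [IsProbabilityMeasure μ] (hμ : IsIsotropicLaw μ) {x : CVec (n + 2)} (hx : x ≠ 0) (t : ℝ) :
    μ {v | ‖inner ℂ x v‖ = t} = 0 := by
  have hx' : 0 < ‖x‖ := norm_pos_iff.2 hx
  set s := t / ‖x‖ with hs
  have hm : MeasurableSet {p : ℝ × ℝ | p.1 = s * p.2} :=
    measurableSet_eq_fun (by fun_prop) (by fun_prop)
  have h := lintegral_lintegral_norm_inner hμ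
    (φ := {p : ℝ × ℝ | p.1 = s * p.2}.indicator 1) (measurable_one.indicator hm)
  have hR : ∫⁻ z : CVec (n + 2), {p : ℝ × ℝ | p.1 = s * p.2}.indicator 1 (‖z 0‖, ‖z‖)
      ∂complexGaussianVec (n + 2) = (0 : ENNReal) := by
    rw [← complexGaussianVec_norm_eval_eq_null (n := n) s, ← lintegral_indicator_one
      (measurableSet_eq_fun (by fun_prop) (by fun_prop))]
    rfl
  rw [hR] at h
  have hi : ∀ z : CVec (n + 2), μ {v | ‖inner ℂ x v‖ = t} ≤
      ∫⁻ v, {p : ℝ × ℝ | p.1 = s * p.2}.indicator 1 (‖inner ℂ z v‖, ‖z‖) ∂μ := by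
    intro z
    have h1 : ‖z‖ = ‖((‖z‖ / ‖x‖ : ℝ) : ℂ) • x‖ := by
      rw [norm_smul, Complex.norm_real, Real.norm_of_nonneg (by positivity)]
      field_simp
    have h2 := lintegral_norm_inner_eq_of_norm_eq hμ.map_unitary
      (φ := fun a => {p : ℝ × ℝ | p.1 = s * p.2}.indicator 1 (a, ‖z‖))
      ((measurable_one.indicator hm).comp (by fun_prop)) h1
    rw [h2, ← lintegral_indicator_one (measurableSet_eq_fun (by fun_prop) (by fun_prop))]
    refine lintegral_mono fun v => ?_
    by_cases hv : ‖inner ℂ x v‖ = t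
    · have h3 : ‖inner ℂ (((‖z‖ / ‖x‖ : ℝ) : ℂ) • x) v‖ = s * ‖z‖ := by
        rw [inner_smul_left, norm_mul, hv, RCLike.norm_conj, Complex.norm_real,
          Real.norm_of_nonneg (by positivity), hs]
        ring
      rw [Set.indicator_of_mem (show v ∈ {v | ‖inner ℂ x v‖ = t} from hv),
        Set.indicator_of_mem (show (_, _) ∈ {p : ℝ × ℝ | p.1 = s * p.2} from h3)]
      rfl
    · rw [Set.indicator_of_notMem (show v ∉ {v | ‖inner ℂ x v‖ = t} from hv)]
      exact zero_le
  have h5 := lintegral_mono (μ := complexGaussianVec (n + 2)) hi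
  rw [lintegral_const, measure_univ, mul_one, h] at h5
  exact le_antisymm h5 zero_le

/-! ### Fourth moment bounds of order `N⁻²`. -/

lemma lintegral_enorm_pow_four_complexGaussian_ne_top :
    ∫⁻ z : ℂ, ‖z‖ₑ ^ 4 ∂complexGaussian ≠ ⊤ := by
  have h := integrable_norm_pow_four_complexGaussian.hasFiniteIntegral
  simp only [HasFiniteIntegral, enorm_pow, enorm_norm] at h
  exact h.ne

lemma sq_le_lintegral_enorm_pow_four_complexGaussianVec (n : ℕ) :
    (n : ENNReal) ^ 2 ≤ ∫⁻ z, ‖z‖ₑ ^ 4 ∂complexGaussianVec n := by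
  have h2 : ∫⁻ z, ‖z‖ₑ ^ 2 ∂complexGaussianVec n = n := by
    have h := ofReal_integral_eq_lintegral_ofReal (integrable_norm_sq_complexGaussianVec n)
      (ae_of_all _ fun z => by positivity)
    rw [integral_norm_sq_complexGaussianVec, ENNReal.ofReal_natCast] at h
    rw [h]
    exact lintegral_congr fun z => by
      rw [ENNReal.ofReal_pow (norm_nonneg z), ofReal_norm]
  -- Jensen's inequality in the form `2na ≤ n² + a²` with `a = ‖z‖²`, which needs no integrability
  -- of `a²`.
  have h3 : ∫⁻ z, 2 * n * ‖z‖ₑ ^ 2 ∂complexGaussianVec n ≤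
      ∫⁻ z, ((n : ENNReal) ^ 2 + ‖z‖ₑ ^ 4) ∂complexGaussianVec n := by
    refine lintegral_mono fun z => ?_
    have := two_mul_le_add_sq (n : ℝ≥0) (‖z‖₊ ^ 2)
    rw [← pow_mul] at this
    have := ENNReal.coe_le_coe.2 this
    push_cast at this
    exact this
  rw [lintegral_const_mul _ (by fun_prop), h2, lintegral_add_left (by fun_prop), lintegral_const,
    measure_univ, mul_one, mul_assoc, two_mul, ← sq] at h3
  exact (ENNReal.add_le_add_iff_left (by finiteness)).1 h3

/-- The fourth moment of a standard complex Gaussian variable. -/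
noncomputable def complexGaussianFourthMoment : ℝ :=
  (∫⁻ z : ℂ, ‖z‖ₑ ^ 4 ∂complexGaussian).toReal

lemma complexGaussianFourthMoment_nonneg : 0 ≤ complexGaussianFourthMoment :=
  ENNReal.toReal_nonneg

/-- Average `|zᴴ v|⁴` over a Gaussian `z`: this is the fourth moment of a single coordinate, and by
homogeneity and invariance also `E‖z‖⁴` times the wanted integral. Divide by `E‖z‖⁴ ≥ N²`. -/
lemma IsIsotropicLaw.integral_norm_inner_pow_four_le {n : ℕ} {μ : Measure (CVec (n + 1))}
    [IsProbabilityMeasure μ] (hμ : IsIsotropicLaw μ) {x : CVec (n + 1)} (hx : ‖x‖ = 1) :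
    ∫ v, ‖inner ℂ x v‖ ^ 4 ∂μ ≤ complexGaussianFourthMoment / ((n : ℝ) + 1) ^ 2 := by
  have h := lintegral_lintegral_norm_inner hμ (φ := fun p => ‖p.1‖ₑ ^ 4) (by fun_prop)
  have hR : ∫⁻ z : CVec (n + 1), ‖‖z 0‖‖ₑ ^ 4 ∂complexGaussianVec (n + 1) =
      ∫⁻ z : ℂ, ‖z‖ₑ ^ 4 ∂complexGaussian := by
    rw [← map_eval_complexGaussianVec (0 : Fin (n + 1)), lintegral_map (by fun_prop) (by fun_prop)]
    simp only [enorm_norm]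
  simp only [hR] at h
  have hi : ∀ z : CVec (n + 1), ∫⁻ v, ‖‖inner ℂ z v‖‖ₑ ^ 4 ∂μ =
      ‖z‖ₑ ^ 4 * ∫⁻ v, ‖inner ℂ x v‖ₑ ^ 4 ∂μ := by
    intro z
    have h1 : ‖z‖ = ‖(‖z‖ : ℂ) • x‖ := by simp [norm_smul, hx]
    rw [lintegral_norm_inner_eq_of_norm_eq hμ.map_unitary (φ := fun a => ‖a‖ₑ ^ 4) (by fun_prop) h1,
      ← lintegral_const_mul _ (by fun_prop)]
    refine lintegral_congr fun v => ?_
    rw [inner_smul_left, norm_mul, enorm_mul, mul_pow]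
    simp
  simp only [hi] at h
  rw [lintegral_mul_const _ (by fun_prop)] at h
  have h2 : ((n + 1 : ℕ) : ENNReal) ^ 2 * ∫⁻ v, ‖inner ℂ x v‖ₑ ^ 4 ∂μ ≤
      ∫⁻ z : ℂ, ‖z‖ₑ ^ 4 ∂complexGaussian :=
    h ▸ mul_le_mul_left (sq_le_lintegral_enorm_pow_four_complexGaussianVec (n + 1)) _
  have h3 := ENNReal.toReal_mono lintegral_enorm_pow_four_complexGaussian_ne_top h2
  rw [ENNReal.toReal_mul, ENNReal.toReal_pow, ENNReal.toReal_natCast, Nat.cast_add_one] at h3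
  rw [integral_eq_lintegral_of_nonneg_ae (ae_of_all _ fun v => by positivity) (by fun_prop),
    le_div_iff₀ (by positivity), mul_comm]
  simp only [ENNReal.ofReal_pow (norm_nonneg _), ofReal_norm]
  exact h3

lemma one_le_one_sub_mul_exp {s : ℝ} (hs : |s| ≤ 1 / 2) :
    1 ≤ (1 - s) * Real.exp (s + 2 * s ^ 2) := by
  have h := abs_le.1 hs
  have h1 := Real.add_one_le_exp (s + 2 * s ^ 2)
  -- The product equals `1 + s² (1 - 2s)`.
  calc 1 ≤ (1 - s) * (s + 2 * s ^ 2 + 1) := by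
        nlinarith [sq_nonneg s, mul_nonneg (sq_nonneg s) (sub_nonneg.2 h.2)]
    _ ≤ _ := mul_le_mul_of_nonneg_left h1 (by linarith)

lemma integral_exp_centered_norm_sq_le (n : ℕ) {s : ℝ} (hs : |s| ≤ 1 / 2) :
    ∫ z : CVec n, Real.exp (s * (‖z‖ ^ 2 - n)) ∂complexGaussianVec n ≤ Real.exp (2 * s ^ 2 * n) := by
  have h := abs_le.1 hs
  have h1 : ∀ z : CVec n, Real.exp (s * (‖z‖ ^ 2 - n)) =
      Real.exp (-s * n) * Real.exp (s * ‖z‖ ^ 2) := by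
    intro z; rw [← Real.exp_add]; ring_nf
  simp_rw [h1]
  rw [integral_const_mul, integral_exp_mul_norm_sq_complexGaussianVec n (by linarith)]
  have h2 : (1 - s)⁻¹ ≤ Real.exp (s + 2 * s ^ 2) := by
    rw [inv_le_iff_one_le_mul₀ (by linarith), mul_comm]
    exact one_le_one_sub_mul_exp hs
  calc _ ≤ Real.exp (-s * n) * Real.exp (s + 2 * s ^ 2) ^ n := by
        have : 0 ≤ (1 - s)⁻¹ := inv_nonneg.2 (by linarith)
        gcongr
    _ = _ := by rw [← Real.exp_nat_mul, ← Real.exp_add]; ring_nf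

lemma pow_four_le_exp_add_exp (y : ℝ) : y ^ 4 ≤ 24 * (Real.exp y + Real.exp (-y)) := by
  have h : ∀ y : ℝ, 0 ≤ y → y ^ 4 ≤ 24 * Real.exp y := fun y hy => by
    have := Real.pow_div_factorial_le_exp y hy 4
    rw [div_le_iff₀ (by positivity)] at this
    norm_num [Nat.factorial] at this
    linarith
  rcases le_total 0 y with hy | hy
  · linarith [h y hy, Real.exp_pos (-y)]
  · have := h (-y) (by linarith)
    rw [show (-y) ^ 4 = y ^ 4 by ring] at this
    linarith [Real.exp_pos y]

/-- A constant bounding the fourth moment of the relative fluctuation of `‖z‖²`. -/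
noncomputable def normSqFluctuationConst : ℝ := 768 * Real.exp (1 / 2)

lemma normSqFluctuation_pow_four (n : ℕ) :
    Integrable (fun z : CVec (n + 1) => (‖z‖ ^ 2 / (n + 1) - 1) ^ 4) (complexGaussianVec (n + 1)) ∧
    ∫ z : CVec (n + 1), (‖z‖ ^ 2 / (n + 1) - 1) ^ 4 ∂complexGaussianVec (n + 1) ≤
      normSqFluctuationConst / ((n : ℝ) + 1) ^ 2 := by
  set N : ℝ := (n : ℝ) + 1 with hN
  have hN1 : 1 ≤ N := by simp [hN]
  have hN0 : 0 < N := by linarith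
  have hNc : ((n + 1 : ℕ) : ℝ) = N := by push_cast; rfl
  -- With this scale `s² N = 1/4`, so the exponential moments at `±s` are at most `e^{1/2}` in every
  -- dimension, while `|s| ≤ 1/2`.
  set s : ℝ := 1 / (2 * √N) with hs
  have hsq : 1 ≤ √N := Real.one_le_sqrt.2 hN1
  have hs2 : s ^ 2 * N = 1 / 4 := by
    rw [hs, div_pow, mul_pow, Real.sq_sqrt hN0.le]; field_simp; norm_num
  have hs0 : 0 ≤ s := by positivity
  have hsle : |s| ≤ 1 / 2 := by
    rw [abs_of_nonneg hs0, hs]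
    exact one_div_le_one_div_of_le (by norm_num) (by linarith)
  have hsle' : |-s| ≤ 1 / 2 := by rwa [abs_neg]
  have hint : ∀ r : ℝ, |r| ≤ 1 / 2 →
      Integrable (fun z : CVec (n + 1) => Real.exp (r * (‖z‖ ^ 2 - N)))
        (complexGaussianVec (n + 1)) := by
    intro r hr
    have := (integrable_exp_mul_norm_sq_complexGaussianVec (n + 1) (s := r)
      (by linarith [(abs_le.1 hr).2])).const_mul (Real.exp (-r * N))
    refine this.congr (ae_of_all _ fun z => ?_)
    simp only
    rw [← Real.exp_add]; ring_nf
  -- Here `384 = 16 · 24`: `16 / N²` is `1 / (s N)⁴`, and `24 = 4!` comes from the exponential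
  -- series.
  have hb : ∀ z : CVec (n + 1), (‖z‖ ^ 2 / N - 1) ^ 4 ≤
      (384 / N ^ 2) * (Real.exp (s * (‖z‖ ^ 2 - N)) + Real.exp (-s * (‖z‖ ^ 2 - N))) := by
    intro z
    have h := pow_four_le_exp_add_exp (s * (‖z‖ ^ 2 - N))
    have h4 : s ^ 4 = 1 / (16 * N ^ 2) := by
      rw [eq_div_iff (by positivity)]
      calc _ = 16 * (s ^ 2 * N) ^ 2 := by ring
        _ = 1 := by rw [hs2]; norm_num
    have h5 : (‖z‖ ^ 2 / N - 1) ^ 4 = 16 / N ^ 2 * (s * (‖z‖ ^ 2 - N)) ^ 4 := by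
      rw [mul_pow, h4]; field_simp
    rw [h5, neg_mul]
    calc _ ≤ 16 / N ^ 2 * (24 * (Real.exp (s * (‖z‖ ^ 2 - N)) +
          Real.exp (-(s * (‖z‖ ^ 2 - N))))) := by gcongr
      _ = _ := by ring
  have hI := ((hint s hsle).add (hint (-s) hsle')).const_mul (384 / N ^ 2)
  have hI4 : Integrable (fun z : CVec (n + 1) => (‖z‖ ^ 2 / N - 1) ^ 4)
      (complexGaussianVec (n + 1)) :=
    hI.mono' (by fun_prop) (ae_of_all _ fun z => by
      rw [Real.norm_of_nonneg (by positivity)]; exact hb z)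
  refine ⟨hI4, (integral_mono hI4 hI hb).trans ?_⟩
  have e1 := integral_exp_centered_norm_sq_le (n + 1) hsle
  have e2 := integral_exp_centered_norm_sq_le (n + 1) hsle'
  rw [hNc, neg_sq] at e2
  rw [hNc] at e1
  rw [mul_assoc 2, hs2] at e1 e2
  rw [integral_const_mul]
  simp only [Pi.add_apply]
  rw [integral_add (hint s hsle) (hint (-s) hsle'), normSqFluctuationConst]
  calc _ ≤ 384 / N ^ 2 * (Real.exp (2 * (1 / 4)) + Real.exp (2 * (1 / 4))) := by gcongr
    _ = _ := by norm_num; ring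

lemma integral_abs_le_of_integral_pow_four_le {α : Type*} [MeasurableSpace α] {μ : Measure α}
    [IsProbabilityMeasure μ] {f : α → ℝ} (hf : AEStronglyMeasurable f μ)
    (hi : Integrable (fun x => f x ^ 4) μ) {N C : ℝ} (hN : 0 < N)
    (h : ∫ x, f x ^ 4 ∂μ ≤ C / N ^ 2) :
    Integrable (fun x => |f x|) μ ∧ ∫ x, |f x| ∂μ ≤ (1 + C) / √N := by
  have hsN : 0 < √N := Real.sqrt_pos.2 hN
  have hb : ∀ x, |f x| ≤ 1 / √N + N ^ 2 / √N * f x ^ 4 := by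
    intro x
    set y := √N * |f x| with hy
    -- This replaces Hölder's inequality, at the price of a worse constant.
    have h1 : y ≤ 1 + y ^ 4 := by
      nlinarith [sq_nonneg (y - 1 / 2), sq_nonneg (y ^ 2 - 1 / 2)]
    have h2 : y ^ 4 = N ^ 2 * f x ^ 4 := by
      rw [hy, mul_pow, Even.pow_abs (by decide), show √N ^ 4 = (√N ^ 2) ^ 2 by ring,
        Real.sq_sqrt hN.le]
    rw [div_mul_eq_mul_div, ← add_div, le_div_iff₀ hsN, mul_comm, ← h2]
    exact h1
  have hI := (integrable_const (μ := μ) (1 / √N)).add (hi.const_mul (N ^ 2 / √N))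
  have hI1 : Integrable (fun x => |f x|) μ :=
    hI.mono' (by simpa using hf.norm) (ae_of_all _ fun x => by
      rw [Real.norm_eq_abs, abs_abs]; exact hb x)
  refine ⟨hI1, (integral_mono hI1 hI hb).trans ?_⟩
  simp only [Pi.add_apply]
  rw [integral_add (integrable_const _) (hi.const_mul _), integral_const_mul]
  simp only [integral_const, probReal_univ, one_smul]
  calc _ ≤ 1 / √N + N ^ 2 / √N * (C / N ^ 2) := by gcongr
    _ = _ := by field_simp

/-! ### The characteristic function of an isotropic unit vector. -/

lemma norm_cexp_mul_I_sub_le (a b : ℝ) :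
    ‖Complex.exp (a * Complex.I) - Complex.exp (b * Complex.I)‖ ≤ |a - b| := by
  have h : Complex.exp (a * Complex.I) - Complex.exp (b * Complex.I) =
      Complex.exp (b * Complex.I) * (Complex.exp (Complex.I * ((a - b : ℝ) : ℂ)) - 1) := by
    rw [mul_sub, ← Complex.exp_add, mul_one]
    congr 2
    push_cast
    ring
  rw [h, norm_mul, Complex.norm_exp_ofReal_mul_I, one_mul]
  exact Real.norm_exp_I_mul_ofReal_sub_one_le

lemma integrable_cexp_inner {n : ℕ} (μ : Measure (CVec n)) [IsFiniteMeasure μ] (t : CVec n) :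
    Integrable (fun v => Complex.exp ((inner ℝ v t : ℝ) * Complex.I)) μ :=
  (integrable_const (1 : ℝ)).mono' (by fun_prop)
    (ae_of_all _ fun v => by rw [Complex.norm_exp_ofReal_mul_I])

lemma IsIsotropicLaw.integrable_norm_inner_pow {n : ℕ} {μ : Measure (CVec n)}
    [IsProbabilityMeasure μ] (hμ : IsIsotropicLaw μ) (x : CVec n) (k : ℕ) :
    Integrable (fun v => ‖inner ℂ x v‖ ^ k) μ := by
  refine (integrable_const (‖x‖ ^ k)).mono' (by fun_prop) (hμ.norm_eq_one.mono fun v hv => ?_)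
  rw [Real.norm_of_nonneg (by positivity)]
  have := norm_inner_le_norm (𝕜 := ℂ) x v
  rw [hv, mul_one] at this
  gcongr

lemma IsIsotropicLaw.integral_norm_inner_le {n : ℕ} {μ : Measure (CVec (n + 1))}
    [IsProbabilityMeasure μ] (hμ : IsIsotropicLaw μ) {x : CVec (n + 1)} (hx : ‖x‖ = 1) :
    ∫ v, ‖inner ℂ x v‖ ∂μ ≤ (1 + complexGaussianFourthMoment) / √((n : ℝ) + 1) := by
  have h := (integral_abs_le_of_integral_pow_four_le (f := fun v => ‖inner ℂ x v‖) (by fun_prop)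
    (hμ.integrable_norm_inner_pow x 4) (by positivity) (hμ.integral_norm_inner_pow_four_le hx)).2
  simpa only [abs_norm] using h

/-- The characteristic function is radial, so both arguments may be put on one ray `ℝ₊ e`; there it
is Lipschitz with constant at most `E|eᴴ v| = O(N^{-1/2})`. -/
lemma IsIsotropicLaw.norm_charFun_sub_le {n : ℕ} {μ : Measure (CVec (n + 1))}
    [IsProbabilityMeasure μ] (hμ : IsIsotropicLaw μ) (s t : CVec (n + 1)) :
    ‖charFun μ s - charFun μ t‖ ≤
      |‖s‖ - ‖t‖| * ((1 + complexGaussianFourthMoment) / √((n : ℝ) + 1)) := by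
  set e : CVec (n + 1) := EuclideanSpace.single 0 1 with he
  have he1 : ‖e‖ = 1 := by simp [he]
  have hn : ∀ x : CVec (n + 1), charFun μ x = charFun μ (‖x‖ • e) := fun x =>
    charFun_eq_of_norm_eq hμ.map_unitary (by simp [norm_smul, he1])
  rw [hn s, hn t, charFun_apply, charFun_apply,
    ← integral_sub (integrable_cexp_inner _ _) (integrable_cexp_inner _ _)]
  have hi : Integrable (fun v => |‖s‖ - ‖t‖| * ‖inner ℂ e v‖) μ := by
    have := (hμ.integrable_norm_inner_pow e 1).const_mul |‖s‖ - ‖t‖|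
    simpa only [pow_one] using this
  refine (norm_integral_le_of_norm_le hi (ae_of_all _ fun v => ?_)).trans ?_
  · refine (norm_cexp_mul_I_sub_le _ _).trans ?_
    rw [real_inner_smul_right, real_inner_smul_right, ← sub_mul, abs_mul, real_inner_cvec,
      norm_inner_symm]
    gcongr
    exact Complex.abs_re_le_norm _
  · rw [integral_const_mul]
    gcongr
    exact hμ.integral_norm_inner_le he1

/-- By Fubini the roles of `v` and `z` swap: the integral averages the Gaussian characteristic
function at `r • v`, which is constant because `‖v‖ = 1`. -/
lemma IsIsotropicLaw.integral_charFun_smul {n : ℕ} {μ : Measure (CVec n)}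
    [IsProbabilityMeasure μ] (hμ : IsIsotropicLaw μ) (r : ℝ) :
    ∫ z, charFun μ (r • z) ∂complexGaussianVec n = Complex.exp (-(r ^ 2 / 4 : ℝ)) := by
  simp only [charFun_apply]
  rw [integral_integral_swap]
  · have h : ∀ v : CVec n, ‖v‖ = 1 →
        ∫ z, Complex.exp ((inner ℝ v (r • z) : ℝ) * Complex.I) ∂complexGaussianVec n =
          Complex.exp (-(r ^ 2 / 4 : ℝ)) := by
      intro v hv
      have := charFun_complexGaussianVec (r • v)
      rw [norm_smul, hv, mul_one, Real.norm_eq_abs, sq_abs, charFun_apply] at this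
      rw [← this]
      refine integral_congr_ae (ae_of_all _ fun z => ?_)
      simp only
      rw [real_inner_smul_right, real_inner_smul_right, real_inner_comm]
    rw [integral_congr_ae (hμ.norm_eq_one.mono h)]
    simp
  · refine (integrable_const (1 : ℝ)).mono' ?_ (ae_of_all _ fun p => ?_)
    · simp only [Function.uncurry_def]
      fun_prop
    · simp only [Function.uncurry_def]
      rw [Complex.norm_exp_ofReal_mul_I]

lemma integral_abs_normSqFluctuation_le (n : ℕ) :
    Integrable (fun z : CVec (n + 1) => |‖z‖ ^ 2 / (n + 1) - 1|) (complexGaussianVec (n + 1)) ∧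
    ∫ z : CVec (n + 1), |‖z‖ ^ 2 / (n + 1) - 1| ∂complexGaussianVec (n + 1) ≤
      (1 + normSqFluctuationConst) / √((n : ℝ) + 1) :=
  integral_abs_le_of_integral_pow_four_le (by fun_prop) (normSqFluctuation_pow_four n).1
    (by positivity) (normSqFluctuation_pow_four n).2

/-- The characteristic function of an isotropic unit vector of `ℂ^N` is close to that of
`CN(0, I / N)`. -/
lemma IsIsotropicLaw.norm_charFun_sub_exp_le {n : ℕ} {μ : Measure (CVec (n + 1))}
    [IsProbabilityMeasure μ] (hμ : IsIsotropicLaw μ) (t : CVec (n + 1)) :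
    ‖charFun μ t - Complex.exp (-(‖t‖ ^ 2 / (n + 1) / 4 : ℝ))‖ ≤
      (1 + complexGaussianFourthMoment) * (1 + normSqFluctuationConst) *
        (‖t‖ / √((n : ℝ) + 1)) * (1 / √((n : ℝ) + 1)) := by
  set N : ℝ := (n : ℝ) + 1 with hN
  have hN0 : 0 < N := by positivity
  have hs0 : 0 < √N := Real.sqrt_pos.2 hN0
  set A := 1 + complexGaussianFourthMoment with hA
  have hA0 : 0 ≤ A := by have := complexGaussianFourthMoment_nonneg; positivity
  -- Since `‖z‖` concentrates at `√N`, the norm of `ρ • z` concentrates at `‖t‖`.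
  set ρ : ℝ := ‖t‖ / √N with hρ
  have hρ0 : 0 ≤ ρ := by positivity
  have h1 := hμ.integral_charFun_smul ρ
  rw [hρ, div_pow, Real.sq_sqrt hN0.le, ← hρ] at h1
  have hint : Integrable (fun z => charFun μ (ρ • z)) (complexGaussianVec (n + 1)) :=
    (integrable_const (1 : ℝ)).mono' (measurable_charFun.comp (by fun_prop)).aestronglyMeasurable
      (ae_of_all _ fun z => norm_charFun_le_one _)
  have h2 : charFun μ t - Complex.exp (-(‖t‖ ^ 2 / N / 4 : ℝ)) =
      ∫ z, (charFun μ t - charFun μ (ρ • z)) ∂complexGaussianVec (n + 1) := by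
    rw [integral_sub (integrable_const _) hint, h1]
    simp
  have hfl := integral_abs_normSqFluctuation_le n
  rw [h2]
  refine (norm_integral_le_of_norm_le (hfl.1.const_mul (A * ρ)) (ae_of_all _ fun z => ?_)).trans ?_
  · refine (hμ.norm_charFun_sub_le _ _).trans ?_
    rw [norm_smul, Real.norm_of_nonneg hρ0, show ‖t‖ = ρ * √N by rw [hρ]; field_simp, ← mul_sub,
      abs_mul, abs_of_nonneg hρ0]
    -- The factor `√N + ‖z‖ ≥ √N` of `N - ‖z‖²` converts fluctuations of the norm into those of its
    -- square.
    have h3 : |√N - ‖z‖| * √N ≤ N * |‖z‖ ^ 2 / N - 1| := by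
      have h4 : N * |‖z‖ ^ 2 / N - 1| = |√N - ‖z‖| * (√N + ‖z‖) := by
        nth_rw 1 [← abs_of_pos hN0]
        rw [← abs_mul, ← abs_of_nonneg (show 0 ≤ √N + ‖z‖ by positivity), ← abs_mul,
          ← abs_neg]
        congr 1
        have := Real.sq_sqrt hN0.le
        field_simp
        linear_combination -this
      rw [h4]
      gcongr
      linarith [norm_nonneg z]
    have h5 : |√N - ‖z‖| ≤ √N * |‖z‖ ^ 2 / N - 1| := by
      have h6 : N = √N * √N := (Real.mul_self_sqrt hN0.le).symm
      refine le_of_mul_le_mul_right ?_ hs0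
      calc _ ≤ _ := h3
        _ = _ := by nth_rw 1 [h6]; ring
    calc _ ≤ ρ * (√N * |‖z‖ ^ 2 / N - 1|) * (A / √N) := by gcongr
      _ = A * ρ * |‖z‖ ^ 2 / N - 1| := by field_simp
  · rw [integral_const_mul]
    calc _ ≤ A * ρ * ((1 + normSqFluctuationConst) / √N) := by
          gcongr
          exact hfl.2
      _ = _ := by ring

lemma tendsto_inv_sqrt_succ : Tendsto (fun n : ℕ => 1 / √((n : ℝ) + 1)) atTop (nhds 0) := by
  have h := (tendsto_one_div_add_atTop_nhds_zero_nat (𝕜 := ℝ)).sqrt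
  simpa using h

/-- The argument may grow like `√N`: the error is `‖t‖/√N`, which stays bounded, times `1/√N`. -/
lemma tendsto_charFun_isotropic {μ : (n : ℕ) → Measure (CVec (n + 1))}
    [∀ n, IsProbabilityMeasure (μ n)] (hμ : ∀ n, IsIsotropicLaw (μ n))
    {t : (n : ℕ) → CVec (n + 1)} {a : ℝ}
    (ht : Tendsto (fun n : ℕ => ‖t n‖ ^ 2 / ((n : ℝ) + 1)) atTop (nhds a)) :
    Tendsto (fun n => charFun (μ n) (t n)) atTop (nhds (Complex.exp (-(a / 4 : ℝ)))) := by
  have h1 : Tendsto (fun n : ℕ => Complex.exp (-(‖t n‖ ^ 2 / ((n : ℝ) + 1) / 4 : ℝ))) atTop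
      (nhds (Complex.exp (-(a / 4 : ℝ)))) := by
    have hc : Continuous fun x : ℝ => Complex.exp (-(x / 4 : ℝ)) := by fun_prop
    exact (hc.tendsto a).comp ht
  have h2 : Tendsto (fun n : ℕ => ‖t n‖ / √((n : ℝ) + 1)) atTop (nhds √a) := by
    refine ht.sqrt.congr fun n => ?_
    rw [Real.sqrt_div (by positivity), Real.sqrt_sq (norm_nonneg _)]
  have h3 := ((h2.const_mul ((1 + complexGaussianFourthMoment) *
    (1 + normSqFluctuationConst))).mul tendsto_inv_sqrt_succ)
  rw [mul_zero] at h3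
  have h4 := squeeze_zero_norm (fun n => (hμ n).norm_charFun_sub_exp_le (t n)) h3
  simpa using h4.add h1

/-! ### Squared moduli of Gaussian coordinates and the chi-square law. -/

lemma gaussianReal_half_eq_map :
    gaussianReal 0 (1 / 2 : ℝ≥0) = (gaussianReal 0 1).map (fun x => √(1 / 2) * x) := by
  rw [gaussianReal_map_const_mul, mul_zero, mul_one]
  congr 1
  ext
  simp

lemma integral_cexp_sq_gaussianReal_half (t : ℝ) :
    ∫ x : ℝ, Complex.exp ((t * x ^ 2 : ℝ) * Complex.I) ∂gaussianReal 0 (1 / 2 : ℝ≥0) =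
      ∫ x : ℝ, Complex.exp ((t * (1 / 2 * x ^ 2) : ℝ) * Complex.I) ∂gaussianReal 0 1 := by
  rw [gaussianReal_half_eq_map, integral_map (by fun_prop) (by fun_prop)]
  simp only [mul_pow, Real.sq_sqrt (show (0 : ℝ) ≤ 1 / 2 by norm_num)]

lemma integral_cexp_norm_sq_complexGaussian (t : ℝ) :
    ∫ z : ℂ, Complex.exp ((t * ‖z‖ ^ 2 : ℝ) * Complex.I) ∂complexGaussian =
      (∫ x : ℝ, Complex.exp ((t * (1 / 2 * x ^ 2) : ℝ) * Complex.I) ∂gaussianReal 0 1) ^ 2 := by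
  rw [complexGaussian, integral_map measurable_complex_mk.aemeasurable (by fun_prop), sq,
    ← integral_cexp_sq_gaussianReal_half, ← integral_prod_mul]
  congr 1 with p
  rw [norm_sq_complex_mk, ← Complex.exp_add]
  push_cast
  ring_nf

lemma map_sum_norm_sq_complexGaussianVec {K : ℕ} (k : Fin K) :
    (complexGaussianVec K).map (fun z => ∑ j ∈ Finset.univ.erase k, ‖z j‖ ^ 2) =
      (chiSquare (2 * (K - 1))).map (fun x => 1 / 2 * x) := by
  have hm1 : Measurable fun z : CVec K => ∑ j ∈ Finset.univ.erase k, ‖z j‖ ^ 2 := by fun_prop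
  have hm2 : Measurable fun x : Fin (2 * (K - 1)) → ℝ => ∑ i, x i ^ 2 := by fun_prop
  have i1 := Measure.isProbabilityMeasure_map (μ := complexGaussianVec K) hm1.aemeasurable
  have i2 := Measure.isProbabilityMeasure_map (μ := chiSquare (2 * (K - 1)))
    (f := fun x : ℝ => 1 / 2 * x) (by fun_prop)
  refine Measure.ext_of_charFun (funext fun t => ?_)
  simp only [charFun_apply]
  set A := ∫ x : ℝ, Complex.exp ((t * (1 / 2 * x ^ 2) : ℝ) * Complex.I) ∂gaussianReal 0 1
  have hL : ∫ x, Complex.exp ((inner ℝ x t : ℝ) * Complex.I) ∂((complexGaussianVec K).map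
      (fun z => ∑ j ∈ Finset.univ.erase k, ‖z j‖ ^ 2)) = (A ^ 2) ^ (K - 1) := by
    rw [integral_map hm1.aemeasurable (by fun_prop), complexGaussianVec,
      ← MeasurableEquiv.coe_toLp, integral_map_equiv]
    -- The omitted user contributes the factor `1`, so that the product runs over all coordinates of
    -- the product measure.
    have h : ∀ z : Fin K → ℂ, Complex.exp ((inner ℝ (∑ j ∈ Finset.univ.erase k,
        ‖(MeasurableEquiv.toLp 2 (Fin K → ℂ) z) j‖ ^ 2) t : ℝ) * Complex.I) =
        ∏ j, if j = k then 1 else Complex.exp ((t * ‖z j‖ ^ 2 : ℝ) * Complex.I) := by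
      intro z
      rw [← Finset.mul_prod_erase _ _ (Finset.mem_univ k), if_pos rfl, one_mul,
        Finset.prod_congr rfl (fun j hj => if_neg (Finset.ne_of_mem_erase hj)), ← Complex.exp_sum,
        ← Finset.sum_mul, ← Complex.ofReal_sum, ← Finset.mul_sum]
      simp
    simp_rw [h]
    rw [integral_fintype_prod_eq_prod
      (fun j (z : ℂ) => if j = k then 1 else Complex.exp ((t * ‖z‖ ^ 2 : ℝ) * Complex.I)),
      ← Finset.mul_prod_erase _ _ (Finset.mem_univ k)]
    have h2 : ∀ j ∈ Finset.univ.erase k, (∫ z : ℂ, (if j = k then 1 else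
        Complex.exp ((t * ‖z‖ ^ 2 : ℝ) * Complex.I)) ∂complexGaussian) = A ^ 2 := by
      intro j hj
      simp only [if_neg (Finset.ne_of_mem_erase hj)]
      exact integral_cexp_norm_sq_complexGaussian t
    rw [Finset.prod_congr rfl h2]
    simp
  have hR : ∫ x, Complex.exp ((inner ℝ x t : ℝ) * Complex.I) ∂((chiSquare (2 * (K - 1))).map
      (fun x => 1 / 2 * x)) = A ^ (2 * (K - 1)) := by
    rw [integral_map (by fun_prop) (by fun_prop), chiSquare,
      integral_map hm2.aemeasurable (by fun_prop)]
    have h : ∀ x : Fin (2 * (K - 1)) → ℝ, Complex.exp ((inner ℝ (1 / 2 * ∑ i, x i ^ 2) t : ℝ) *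
        Complex.I) = ∏ i, Complex.exp ((t * (1 / 2 * x i ^ 2) : ℝ) * Complex.I) := by
      intro x
      rw [← Complex.exp_sum, ← Finset.sum_mul, ← Complex.ofReal_sum, ← Finset.mul_sum,
        ← Finset.mul_sum]
      simp
    simp_rw [h]
    rw [integral_fintype_prod_eq_pow
      (fun x : ℝ => Complex.exp ((t * (1 / 2 * x ^ 2) : ℝ) * Complex.I)), Fintype.card_fin]
  rw [hL, hR, ← pow_mul]

/-! ### Leakage for deterministic, asymptotically orthogonal channels. -/

/-- The vector of the Hermitian products `y_jᴴ w`. -/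
noncomputable def crossVec {n K : ℕ} (y : Fin K → CVec n) (w : CVec n) : CVec K :=
  WithLp.toLp 2 fun j => inner ℂ (y j) w

lemma measurable_crossVec {n K : ℕ} (y : Fin K → CVec n) : Measurable (crossVec y) := by
  unfold crossVec
  fun_prop

/-- The map `crossVec y` is the adjoint of `s ↦ ∑ s_j y_j`. -/
lemma charFun_map_crossVec {n K : ℕ} (μ : Measure (CVec n)) (y : Fin K → CVec n) (s : CVec K) :
    charFun (μ.map (crossVec y)) s = charFun μ (∑ j, s j • y j) := by
  rw [charFun_apply, charFun_apply, integral_map (measurable_crossVec y).aemeasurable (by fun_prop)]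
  refine integral_congr_ae (ae_of_all _ fun w => ?_)
  simp only
  rw [real_inner_cvec, real_inner_cvec, inner_sum, PiLp.inner_apply]
  congr 4
  refine Finset.sum_congr rfl fun j _ => ?_
  rw [inner_smul_right, crossVec, RCLike.inner_apply, inner_conj_symm]

/-- The Gram matrix of the vectors `y n j ∈ ℂ^(n+1)`, divided by the dimension, tends to the
identity. -/
def GramTendstoOne {K : ℕ} (y : (n : ℕ) → Fin K → CVec (n + 1)) : Prop :=
  ∀ i j, Tendsto (fun n : ℕ => inner ℂ (y n i) (y n j) / ((n : ℂ) + 1)) atTop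
    (nhds (if i = j then 1 else 0))

lemma GramTendstoOne.tendsto_norm_sq_sum {K : ℕ} {y : (n : ℕ) → Fin K → CVec (n + 1)}
    (hy : GramTendstoOne y) (s : CVec K) :
    Tendsto (fun n : ℕ => ‖∑ j, s j • y n j‖ ^ 2 / ((n : ℝ) + 1)) atTop (nhds (‖s‖ ^ 2)) := by
  have h : Tendsto (fun n : ℕ => ∑ i, ∑ j, (starRingEnd ℂ (s i) * s j) *
      (inner ℂ (y n i) (y n j) / ((n : ℂ) + 1))) atTop
      (nhds (∑ i, ∑ j, (starRingEnd ℂ (s i) * s j) * (if i = j then 1 else 0))) :=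
    tendsto_finsetSum _ fun i _ => tendsto_finsetSum _ fun j _ => (hy i j).const_mul _
  have h2 := (Complex.continuous_re.tendsto _).comp h
  have e1 : (∑ i, ∑ j, (starRingEnd ℂ (s i) * s j) * (if i = j then 1 else 0)).re = ‖s‖ ^ 2 := by
    simp only [mul_ite, mul_one, mul_zero, Finset.sum_ite_eq, Finset.mem_univ, if_true]
    rw [Complex.re_sum, EuclideanSpace.norm_sq_eq]
    refine Finset.sum_congr rfl fun i _ => ?_
    rw [Complex.conj_mul', ← Complex.ofReal_pow, Complex.ofReal_re]
  rw [e1] at h2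
  refine h2.congr fun n => ?_
  have e2 : (∑ i, ∑ j, (starRingEnd ℂ (s i) * s j) * (inner ℂ (y n i) (y n j) / ((n : ℂ) + 1))) =
      ((‖∑ j, s j • y n j‖ ^ 2 / ((n : ℝ) + 1) : ℝ) : ℂ) := by
    push_cast
    rw [← Complex.coe_algebraMap, ← inner_self_eq_norm_sq_to_K (𝕜 := ℂ), sum_inner, Finset.sum_div]
    refine Finset.sum_congr rfl fun i _ => ?_
    rw [inner_sum, Finset.sum_div]
    refine Finset.sum_congr rfl fun j _ => ?_
    rw [inner_smul_left, inner_smul_right]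
    ring
  simp only [Function.comp_apply]
  rw [e2, Complex.ofReal_re]

lemma measurable_leakage_right {n K : ℕ} (k : Fin K) (y : Fin K → CVec n) :
    Measurable (leakage k y) := by
  unfold leakage
  fun_prop

/-- The law of half a `χ²` variable with `d` degrees of freedom. -/
noncomputable def halfChiSquare (d : ℕ) : ProbabilityMeasure ℝ :=
  ⟨(chiSquare d).map (fun x => 1 / 2 * x), Measure.isProbabilityMeasure_map (by fun_prop)⟩

/-- For deterministic vectors that are asymptotically orthogonal with norm `√N`, the leakage of
an isotropic unit vector is asymptotically half a `χ²` variable. -/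
lemma tendsto_map_leakage {K : ℕ} (k : Fin K) {μ : (n : ℕ) → ProbabilityMeasure (CVec (n + 1))}
    (hμ : ∀ n, IsIsotropicLaw (μ n : Measure (CVec (n + 1))))
    {y : (n : ℕ) → Fin K → CVec (n + 1)} (hy : GramTendstoOne y) :
    Tendsto (fun n => (μ n).map (measurable_leakage_right k (y n)).aemeasurable) atTop
      (nhds (halfChiSquare (2 * (K - 1)))) := by
  have h1 : Tendsto (fun n => (μ n).map (measurable_crossVec (y n)).aemeasurable) atTop
      (nhds (⟨complexGaussianVec K, inferInstance⟩ : ProbabilityMeasure (CVec K))) := by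
    refine ProbabilityMeasure.tendsto_iff_tendsto_charFun.2 fun s => ?_
    simp only [ProbabilityMeasure.toMeasure_map, ProbabilityMeasure.coe_mk, charFun_map_crossVec,
      charFun_complexGaussianVec]
    exact tendsto_charFun_isotropic hμ (hy.tendsto_norm_sq_sum s)
  have hc : Continuous fun z : CVec K => ∑ j ∈ Finset.univ.erase k, ‖z j‖ ^ 2 := by fun_prop
  have h2 := ProbabilityMeasure.tendsto_map_of_tendsto_of_continuous _ _ h1 hc
  have e : ProbabilityMeasure.map (⟨complexGaussianVec K, inferInstance⟩ :
      ProbabilityMeasure (CVec K)) hc.measurable.aemeasurable = halfChiSquare (2 * (K - 1)) :=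
    Subtype.ext (map_sum_norm_sq_complexGaussianVec k)
  rw [e] at h2
  refine h2.congr fun n => Subtype.ext ?_
  exact Measure.map_map hc.measurable (measurable_crossVec _)

/-! ### Almost sure convergence from summable moments. -/

/-- The expectation of `∑ X_n⁴` is finite, so the series converges almost surely and its terms
vanish. Nothing is asked about the joint law of the `X_n`. -/
lemma ae_tendsto_zero_of_integral_pow_four_le {Ω : Type*} [MeasurableSpace Ω] {P : Measure Ω}
    {X : ℕ → Ω → ℝ} {C : ℝ} (hi : ∀ n, Integrable (fun ω => X n ω ^ 4) P)
    (h : ∀ n, ∫ ω, X n ω ^ 4 ∂P ≤ C / ((n : ℝ) + 1) ^ 2) :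
    ∀ᵐ ω ∂P, Tendsto (fun n => X n ω) atTop (nhds 0) := by
  have hm : ∀ n, AEMeasurable (fun ω => ENNReal.ofReal (X n ω ^ 4)) P := fun n =>
    (hi n).aestronglyMeasurable.aemeasurable.ennreal_ofReal
  have hs : Summable fun n : ℕ => C / ((n : ℝ) + 1) ^ 2 := by
    have := (summable_nat_add_iff 1).2 (Real.summable_one_div_nat_pow.2 one_lt_two)
    simpa [div_eq_mul_inv] using this.mul_left C
  have hfin : ∫⁻ ω, ∑' n, ENNReal.ofReal (X n ω ^ 4) ∂P ≠ ⊤ := by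
    rw [lintegral_tsum hm]
    refine ne_top_of_le_ne_top hs.tsum_ofReal_ne_top (ENNReal.tsum_le_tsum fun n => ?_)
    rw [← ofReal_integral_eq_lintegral_ofReal (hi n) (ae_of_all _ fun ω => by positivity)]
    exact ENNReal.ofReal_le_ofReal (h n)
  filter_upwards [ae_lt_top' (AEMeasurable.tsum hm) hfin] with ω hω
  have h1 := ENNReal.tendsto_atTop_zero_of_tsum_ne_top hω.ne
  have h2 := ((ENNReal.tendsto_toReal ENNReal.zero_ne_top).comp h1).sqrt.sqrt
  simp only [ENNReal.toReal_zero, Real.sqrt_zero] at h2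
  refine squeeze_zero_norm (fun n => le_of_eq ?_) h2
  simp only [Function.comp_apply]
  rw [ENNReal.toReal_ofReal (by positivity), show X n ω ^ 4 = (X n ω ^ 2) ^ 2 by ring,
    Real.sqrt_sq (by positivity), Real.sqrt_sq_eq_abs, Real.norm_eq_abs]

lemma ae_tendsto_norm_sq_div {Ω : Type*} [MeasurableSpace Ω] {P : Measure Ω}
    {X : (n : ℕ) → Ω → CVec (n + 1)} (hX : ∀ n, HasLaw (X n) (complexGaussianVec (n + 1)) P) :
    ∀ᵐ ω ∂P, Tendsto (fun n : ℕ => ‖X n ω‖ ^ 2 / ((n : ℝ) + 1)) atTop (nhds 1) := by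
  have h := ae_tendsto_zero_of_integral_pow_four_le (P := P)
    (X := fun n ω => ‖X n ω‖ ^ 2 / ((n : ℝ) + 1) - 1) (C := normSqFluctuationConst)
    (fun n => by
      have := (normSqFluctuation_pow_four n).1
      rw [← (hX n).map_eq, integrable_map_measure (by fun_prop) (hX n).aemeasurable] at this
      exact this)
    (fun n => by
      have := (normSqFluctuation_pow_four n).2
      rwa [← (hX n).map_eq, integral_map (hX n).aemeasurable (by fun_prop)] at this)
  filter_upwards [h] with ω hω
  simpa using hω.add_const 1

/-! ### Quantized directions: ties, isotropy, independence. -/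

open Classical in
/-- The sum of all the maximizers of `|hᴴ u|` in the codebook `c`: without ties this is the
quantized direction. -/
noncomputable def bestCodeword {n : ℕ} {ι : Type*} [Fintype ι] (h : CVec n) (c : ι → CVec n) :
    CVec n :=
  ∑ a, if ∀ b, ‖inner ℂ h (c b)‖ ≤ ‖inner ℂ h (c a)‖ then c a else 0

/-- Summing over all maximizers avoids a tie-breaking rule, so only inner products decide which
codewords enter. -/
lemma bestCodeword_map {n : ℕ} {ι : Type*} [Fintype ι] (U : CVec n ≃ₗᵢ[ℂ] CVec n) (h : CVec n)
    (c : ι → CVec n) : bestCodeword (U h) (fun a => U (c a)) = U (bestCodeword h c) := by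
  simp only [bestCodeword, LinearIsometryEquiv.inner_map_map, map_sum]
  refine Finset.sum_congr rfl fun a _ => ?_
  split_ifs <;> simp

lemma measurable_bestCodeword {n : ℕ} {ι : Type*} [Fintype ι] {α : Type*} [MeasurableSpace α]
    {h : α → CVec n} {c : ι → α → CVec n} (hh : Measurable h) (hc : ∀ a, Measurable (c a)) :
    Measurable fun x => bestCodeword (h x) (fun a => c a x) := by
  unfold bestCodeword
  refine Finset.measurable_sum _ fun a _ => Measurable.ite ?_ (hc a) measurable_const
  simp only [Set.ofPred_forall]
  exact MeasurableSet.iInter fun b => measurableSet_le (by fun_prop) (by fun_prop)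

lemma IsQuantizedDirection.eq_bestCodeword {n : ℕ} {ι : Type*} [Fintype ι] {h : CVec n}
    {c : ι → CVec n} {g : CVec n} (hg : IsQuantizedDirection h c g)
    (hties : ∀ a b, a ≠ b → ‖inner ℂ h (c a)‖ ≠ ‖inner ℂ h (c b)‖) : g = bestCodeword h c := by
  obtain ⟨a, rfl, ha⟩ := hg
  rw [bestCodeword, Finset.sum_eq_single a, if_pos ha]
  · intro b _ hba
    rw [if_neg]
    intro hb
    exact hties b a hba (le_antisymm (ha b) (hb a))
  · simp

lemma complexGaussianVec_ae_ne_zero (n : ℕ) : ∀ᵐ z ∂complexGaussianVec (n + 1), z ≠ 0 := by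
  refine measure_mono_null (fun z hz => ?_) (measure_eval_complexGaussianVec_eq_zero (n := n + 1) 0)
  have hz0 : z = 0 := by simpa using hz
  show z 0 = 0
  rw [hz0]
  rfl

/-- In dimension at least two, an independent isotropic unit vector almost surely does not produce
a prescribed correlation with a nonzero vector. -/
lemma ae_norm_inner_ne {Ω : Type*} [MeasurableSpace Ω] {P : Measure Ω} [IsProbabilityMeasure P]
    {n : ℕ} {X V W : Ω → CVec (n + 2)} (hX : HasLaw X (complexGaussianVec (n + 2)) P)
    (hV : AEMeasurable V P) (hW : IsIsotropicUnitVector P W)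
    (hind : IndepFun (fun ω => (X ω, V ω)) W P) :
    ∀ᵐ ω ∂P, ‖inner ℂ (X ω) (V ω)‖ ≠ ‖inner ℂ (X ω) (W ω)‖ := by
  have hXV : AEMeasurable (fun ω => (X ω, V ω)) P := hX.aemeasurable.prodMk hV
  have hWm := hW.aemeasurable
  have := Measure.isProbabilityMeasure_map hWm
  have := Measure.isProbabilityMeasure_map hXV
  have hms : MeasurableSet {p : (CVec (n + 2) × CVec (n + 2)) × CVec (n + 2) |
      ‖inner ℂ p.1.1 p.1.2‖ = ‖inner ℂ p.1.1 p.2‖} :=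
    measurableSet_eq_fun (by fun_prop) (by fun_prop)
  have hms' : MeasurableSet {p : (CVec (n + 2) × CVec (n + 2)) × CVec (n + 2) |
      ¬ (‖inner ℂ p.1.1 p.1.2‖ = ‖inner ℂ p.1.1 p.2‖)} := hms.compl
  have h0 : ∀ᵐ p ∂(P.map (fun ω => (X ω, V ω))).prod (P.map W),
      ¬ (‖inner ℂ p.1.1 p.1.2‖ = ‖inner ℂ p.1.1 p.2‖) := by
    rw [Measure.ae_prod_iff_ae_ae hms']
    have hne := complexGaussianVec_ae_ne_zero (n + 1)
    have h1 : MeasurableSet {z : CVec (n + 2) | z ≠ 0} := (measurableSet_singleton 0).compl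
    have h2 : MeasurableSet {p : CVec (n + 2) × CVec (n + 2) | p.1 ≠ 0} :=
      h1.preimage measurable_fst
    rw [← hX.map_eq, ae_map_iff hX.aemeasurable h1] at hne
    have hne' : ∀ᵐ p ∂P.map (fun ω => (X ω, V ω)), p.1 ≠ 0 := by
      rwa [ae_map_iff hXV h2]
    filter_upwards [hne'] with p hp
    have := hW.isIsotropicLaw.measure_norm_inner_eq_null hp ‖inner ℂ p.1 p.2‖
    rw [ae_iff]
    simpa [eq_comm] using this
  rw [← hind.map_prod_eq_prod_map_map hXV hWm, ae_map_iff (hXV.prodMk hWm) hms'] at h0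
  exact h0

section Family

variable {Ω : Type*} [MeasurableSpace Ω] {P : Measure Ω}

lemma IsQuantizedDirection.ae_norm_eq_one {m : ℕ} {ι : Type*} [Countable ι] {h g : Ω → CVec m}
    {c : ι → Ω → CVec m} (c_iso : ∀ a, IsIsotropicUnitVector P (c a))
    (g_argmax : ∀ᵐ ω ∂P, IsQuantizedDirection (h ω) (fun a => c a ω) (g ω)) :
    ∀ᵐ ω ∂P, ‖g ω‖ = 1 := by
  filter_upwards [g_argmax, ae_all_iff.2 fun a => (c_iso a).norm_eq_one] with ω ⟨a, ha, _⟩ h2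
  rw [ha]
  exact h2 a

variable {K M n : ℕ} {h : Fin K → Ω → CVec (n + 2)} {c : Fin K → Fin M → Ω → CVec (n + 2)}
  {g : Fin K → Ω → CVec (n + 2)}

lemma aemeasurable_channelFamily (h_law : ∀ j, HasLaw (h j) (complexGaussianVec (n + 2)) P)
    (c_iso : ∀ j a, IsIsotropicUnitVector P (c j a)) (x : Fin K ⊕ Fin K × Fin M) :
    AEMeasurable (Sum.elim h (fun p : Fin K × Fin M => c p.1 p.2) x) P := by
  rcases x with j | p
  · exact (h_law j).aemeasurable
  · exact (c_iso p.1 p.2).aemeasurable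

variable [IsProbabilityMeasure P]

lemma map_family_linearIsometryEquiv {n : ℕ} {ι : Type*} [Fintype ι] {y : ι → Ω → CVec n}
    (hy : ∀ i, AEMeasurable (y i) P) (hind : iIndepFun y P) (U : CVec n ≃ₗᵢ[ℂ] CVec n)
    (hU : ∀ i, (P.map (y i)).map U = P.map (y i)) :
    (P.map (fun ω i => y i ω)).map (fun x i => U (x i)) = P.map (fun ω i => y i ω) := by
  have := fun i => Measure.isProbabilityMeasure_map (hy i)
  rw [(iIndepFun_iff_map_fun_eq_pi_map hy).1 hind]
  have : ∀ i, SigmaFinite ((P.map (y i)).map U) := fun i => by rw [hU]; infer_instance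
  rw [Measure.pi_map_pi (fun i => (measurable_linearIsometryEquiv U).aemeasurable)]
  simp only [hU]

/-- The pair `(h_j, c_{j,a})` is independent of `c_{j,b}`, so each possible tie is null. Dimension
at least two matters: in dimension one all codewords tie almost surely. -/
lemma ae_eq_bestCodeword (h_law : ∀ j, HasLaw (h j) (complexGaussianVec (n + 2)) P)
    (c_iso : ∀ j a, IsIsotropicUnitVector P (c j a))
    (hc_indep : iIndepFun (Sum.elim h (fun p : Fin K × Fin M => c p.1 p.2)) P)
    (g_argmax : ∀ j, ∀ᵐ ω ∂P, IsQuantizedDirection (h j ω) (fun a => c j a ω) (g j ω))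
    (j : Fin K) : g j =ᵐ[P] fun ω => bestCodeword (h j ω) (fun a => c j a ω) := by
  have hties : ∀ᵐ ω ∂P, ∀ a b, a ≠ b →
      ‖inner ℂ (h j ω) (c j a ω)‖ ≠ ‖inner ℂ (h j ω) (c j b ω)‖ := by
    rw [ae_all_iff]; intro a
    rw [ae_all_iff]; intro b
    by_cases hab : a = b
    · exact ae_of_all _ fun ω hne => absurd hab hne
    have hi := hc_indep.indepFun_prodMk₀ (aemeasurable_channelFamily h_law c_iso)
      (Sum.inl j) (Sum.inr (j, a)) (Sum.inr (j, b)) (by simp) (by simp [hab])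
    filter_upwards [ae_norm_inner_ne (h_law j) (c_iso j a).aemeasurable (c_iso j b) hi] with ω hω _
    exact hω
  filter_upwards [hties, g_argmax j] with ω h1 h2
  exact h2.eq_bestCodeword h1

/-- Rotating all channels and codewords at once preserves their joint law, and the direction is
almost surely an equivariant function of them. -/
lemma isIsotropicUnitVector_quantized
    (h_law : ∀ j, HasLaw (h j) (complexGaussianVec (n + 2)) P)
    (c_iso : ∀ j a, IsIsotropicUnitVector P (c j a))
    (hc_indep : iIndepFun (Sum.elim h (fun p : Fin K × Fin M => c p.1 p.2)) P)
    (g_meas : ∀ j, AEMeasurable (g j) P)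
    (g_argmax : ∀ j, ∀ᵐ ω ∂P, IsQuantizedDirection (h j ω) (fun a => c j a ω) (g j ω))
    (j : Fin K) : IsIsotropicUnitVector P (g j) where
  aemeasurable := g_meas j
  norm_eq_one := IsQuantizedDirection.ae_norm_eq_one (c_iso j) (g_argmax j)
  map_unitary U := by
    set y := Sum.elim h (fun p : Fin K × Fin M => c p.1 p.2) with hy
    have hym := aemeasurable_channelFamily h_law c_iso
    have hbest := ae_eq_bestCodeword h_law c_iso hc_indep g_argmax j
    have hU : ∀ i, (P.map (y i)).map U = P.map (y i) := by
      rintro (i | p)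
      · simp only [hy, Sum.elim_inl, (h_law i).map_eq]
        exact map_linearIsometryEquiv_complexGaussianVec U
      · exact (c_iso p.1 p.2).isIsotropicLaw.map_unitary U
    have hfam := map_family_linearIsometryEquiv hym hc_indep U hU
    set G : (Fin K ⊕ Fin K × Fin M → CVec (n + 2)) → CVec (n + 2) := fun x =>
      bestCodeword (x (Sum.inl j)) (fun a => x (Sum.inr (j, a))) with hG
    have hGm : Measurable G := measurable_bestCodeword (by fun_prop) (fun a => by fun_prop)
    have hfm : Measurable fun (x : Fin K ⊕ Fin K × Fin M → CVec (n + 2)) i => U (x i) :=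
      measurable_pi_lambda _ fun i =>
        (measurable_linearIsometryEquiv U).comp (measurable_pi_apply i)
    have hYm : AEMeasurable (fun ω i => y i ω) P := aemeasurable_pi_lambda _ hym
    have e1 : P.map (g j) = (P.map (fun ω i => y i ω)).map G := by
      rw [Measure.map_congr hbest, AEMeasurable.map_map_of_aemeasurable hGm.aemeasurable hYm]
      rfl
    have e2 : P.map (fun ω => U (g j ω)) = (P.map (g j)).map U := by
      rw [AEMeasurable.map_map_of_aemeasurable (measurable_linearIsometryEquiv U).aemeasurable
        (g_meas j)]
      rfl
    rw [e2, e1, Measure.map_map (measurable_linearIsometryEquiv U) hGm]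
    nth_rw 2 [← hfam]
    rw [Measure.map_map hGm hfm]
    congr 1
    funext x
    exact (bestCodeword_map U _ _).symm

/-- Each direction is almost surely a function of its own user's channel and codebook, and the
blocks of distinct users are disjoint. -/
lemma indepFun_quantized
    (h_law : ∀ j, HasLaw (h j) (complexGaussianVec (n + 2)) P)
    (c_iso : ∀ j a, IsIsotropicUnitVector P (c j a))
    (hc_indep : iIndepFun (Sum.elim h (fun p : Fin K × Fin M => c p.1 p.2)) P)
    (g_argmax : ∀ j, ∀ᵐ ω ∂P, IsQuantizedDirection (h j ω) (fun a => c j a ω) (g j ω))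
    {i j : Fin K} (hij : i ≠ j) : IndepFun (g i) (g j) P := by
  have hbest := ae_eq_bestCodeword h_law c_iso hc_indep g_argmax
  let user : Fin K ⊕ Fin K × Fin M → Fin K := Sum.elim id Prod.fst
  let S : Fin K → Finset (Fin K ⊕ Fin K × Fin M) := fun i => Finset.univ.filter (user · = i)
  have hS : Disjoint (S i) (S j) := by
    rw [Finset.disjoint_left]
    intro x hx hx'
    simp only [S, Finset.mem_filter, Finset.mem_univ, true_and] at hx hx'
    exact hij (hx.symm.trans hx')
  have hind := hc_indep.indepFun_finset₀ (S i) (S j) hS (aemeasurable_channelFamily h_law c_iso)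
  let F : (i : Fin K) → (S i → CVec (n + 2)) → CVec (n + 2) := fun i u =>
    bestCodeword (u ⟨Sum.inl i, by simp [S, user]⟩)
      (fun a => u ⟨Sum.inr (i, a), by simp [S, user]⟩)
  have hF : ∀ i, Measurable (F i) := fun i =>
    measurable_bestCodeword (by fun_prop) (fun a => by fun_prop)
  exact (hind.comp (hF i) (hF j)).congr (hbest i).symm (hbest j).symm

lemma integral_norm_inner_quantized_pow_four_le
    (h_law : ∀ j, HasLaw (h j) (complexGaussianVec (n + 2)) P)
    (c_iso : ∀ j a, IsIsotropicUnitVector P (c j a))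
    (hc_indep : iIndepFun (Sum.elim h (fun p : Fin K × Fin M => c p.1 p.2)) P)
    (g_meas : ∀ j, AEMeasurable (g j) P)
    (g_argmax : ∀ j, ∀ᵐ ω ∂P, IsQuantizedDirection (h j ω) (fun a => c j a ω) (g j ω))
    {i j : Fin K} (hij : i ≠ j) :
    Integrable (fun ω => ‖inner ℂ (g i ω) (g j ω)‖ ^ 4) P ∧
    ∫ ω, ‖inner ℂ (g i ω) (g j ω)‖ ^ 4 ∂P ≤ complexGaussianFourthMoment / ((n : ℝ) + 1) ^ 2 := by
  have iso := isIsotropicUnitVector_quantized h_law c_iso hc_indep g_meas g_argmax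
  have hm : AEMeasurable (fun ω => (g i ω, g j ω)) P := (g_meas i).prodMk (g_meas j)
  have i1 := Measure.isProbabilityMeasure_map (g_meas i)
  have i2 := Measure.isProbabilityMeasure_map (g_meas j)
  have hI : Integrable (fun ω => ‖inner ℂ (g i ω) (g j ω)‖ ^ 4) P := by
    refine (integrable_const (1 : ℝ)).mono'
      (((g_meas i).inner (g_meas j)).norm.pow_const 4).aestronglyMeasurable ?_
    filter_upwards [(iso i).norm_eq_one, (iso j).norm_eq_one] with ω h1 h2
    rw [Real.norm_of_nonneg (by positivity)]
    have := norm_inner_le_norm (𝕜 := ℂ) (g i ω) (g j ω)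
    rw [h1, h2, mul_one] at this
    exact pow_le_one₀ (norm_nonneg _) this
  refine ⟨hI, ?_⟩
  have hmap := (indepFun_quantized h_law c_iso hc_indep g_argmax hij).map_prod_eq_prod_map_map
    (g_meas i) (g_meas j)
  have hc : Continuous fun p : CVec (n + 2) × CVec (n + 2) => ‖inner ℂ p.1 p.2‖ ^ 4 := by fun_prop
  have hI2 : Integrable (fun p : CVec (n + 2) × CVec (n + 2) => ‖inner ℂ p.1 p.2‖ ^ 4)
      ((P.map (g i)).prod (P.map (g j))) := by
    rw [← hmap, integrable_map_measure hc.aestronglyMeasurable hm]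
    exact hI
  have e : ∫ ω, ‖inner ℂ (g i ω) (g j ω)‖ ^ 4 ∂P =
      ∫ x, ∫ v, ‖inner ℂ x v‖ ^ 4 ∂P.map (g j) ∂P.map (g i) := by
    rw [← integral_prod _ hI2, ← hmap, integral_map hm hc.aestronglyMeasurable]
  rw [e]
  have hle : ∀ᵐ x ∂P.map (g i), ∫ v, ‖inner ℂ x v‖ ^ 4 ∂P.map (g j) ≤
      complexGaussianFourthMoment / ((n : ℝ) + 1) ^ 2 := by
    filter_upwards [(iso i).isIsotropicLaw.norm_eq_one] with x hx
    -- The dimension is `n + 2`; the bound is weakened to `(n + 1)²` to match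
    -- `ae_tendsto_zero_of_integral_pow_four_le`.
    refine ((iso j).isIsotropicLaw.integral_norm_inner_pow_four_le hx).trans ?_
    have := complexGaussianFourthMoment_nonneg
    gcongr
    simp
  refine (integral_mono_ae hI2.integral_prod_left (integrable_const _) hle).trans_eq ?_
  simp

end Family

/-! ### Asymptotic orthogonality of the quantized channels. -/

/-- The quantized channels are almost surely asymptotically orthogonal with norm `√N`. -/
lemma ae_gramTendstoOne_quantizedChannel {Ω : Type*} [MeasurableSpace Ω]
    {P : Measure Ω} [IsProbabilityMeasure P] {K : ℕ} {M : ℕ → ℕ}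
    {h : (n : ℕ) → Fin K → Ω → CVec (n + 1)}
    {c : (n : ℕ) → Fin K → Fin (M n) → Ω → CVec (n + 1)}
    {g : (n : ℕ) → Fin K → Ω → CVec (n + 1)}
    (h_law : ∀ n j, HasLaw (h n j) (complexGaussianVec (n + 1)) P)
    (c_iso : ∀ n j a, IsIsotropicUnitVector P (c n j a))
    (hc_indep : ∀ n, iIndepFun
      (Sum.elim (h n) (fun p : Fin K × Fin (M n) => c n p.1 p.2)) P)
    (g_meas : ∀ n j, AEMeasurable (g n j) P)
    (g_argmax : ∀ n j, ∀ᵐ ω ∂P,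
      IsQuantizedDirection (h n j ω) (fun a => c n j a ω) (g n j ω)) :
    ∀ᵐ ω ∂P, GramTendstoOne fun n j => quantizedChannel (h n j ω) (g n j ω) := by
  have hnorm : ∀ᵐ ω ∂P, ∀ j,
      Tendsto (fun n : ℕ => ‖h n j ω‖ ^ 2 / ((n : ℝ) + 1)) atTop (nhds 1) :=
    ae_all_iff.2 fun j => ae_tendsto_norm_sq_div fun n => h_law n j
  have hg1 : ∀ᵐ ω ∂P, ∀ n j, ‖g n j ω‖ = 1 :=
    ae_all_iff.2 fun n => ae_all_iff.2 fun j =>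
      IsQuantizedDirection.ae_norm_eq_one (c_iso n j) (g_argmax n j)
  have hcross : ∀ᵐ ω ∂P, ∀ i j, i ≠ j →
      Tendsto (fun n => ‖inner ℂ (g n i ω) (g n j ω)‖) atTop (nhds 0) := by
    refine ae_all_iff.2 fun i => ae_all_iff.2 fun j => ?_
    by_cases hij : i = j
    · exact ae_of_all _ fun ω hne => absurd hij hne
    -- The index shift discards dimension one, where ties cannot be excluded; the limit is
    -- unaffected.
    have hb := fun n => integral_norm_inner_quantized_pow_four_le (n := n) (h_law (n + 1))
      (c_iso (n + 1)) (hc_indep (n + 1)) (g_meas (n + 1)) (g_argmax (n + 1)) hij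
    filter_upwards [ae_tendsto_zero_of_integral_pow_four_le
      (X := fun n ω => ‖inner ℂ (g (n + 1) i ω) (g (n + 1) j ω)‖)
      (fun n => (hb n).1) (fun n => (hb n).2)] with ω hω _
    exact (tendsto_add_atTop_iff_nat 1).1 hω
  filter_upwards [hnorm, hg1, hcross] with ω h1 h2 h3 i j
  by_cases hij : i = j
  · subst hij
    rw [if_pos rfl]
    have := (Complex.continuous_ofReal.tendsto _).comp (h1 i)
    rw [Complex.ofReal_one] at this
    refine this.congr fun n => ?_
    simp only [quantizedChannel]
    rw [inner_smul_left, inner_smul_right, inner_self_eq_norm_sq_to_K, h2]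
    simp [sq]
  · rw [if_neg hij]
    have h4 := ((h1 i).sqrt.mul (h1 j).sqrt).mul (h3 i j hij)
    rw [mul_zero] at h4
    refine squeeze_zero_norm (fun n => le_of_eq ?_) h4
    have hN : ‖(n : ℂ) + 1‖ = √((n : ℝ) + 1) * √((n : ℝ) + 1) := by
      rw [Real.mul_self_sqrt (by positivity)]
      exact_mod_cast Complex.norm_natCast (n + 1)
    simp only [quantizedChannel]
    rw [inner_smul_left, inner_smul_right, norm_div, hN,
      Real.sqrt_div (by positivity), Real.sqrt_div (by positivity), Real.sqrt_sq (norm_nonneg _),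
      Real.sqrt_sq (norm_nonneg _)]
    simp only [norm_mul, Complex.conj_ofReal, Complex.norm_real, norm_norm]
    ring

/-! ### From fixed channel realizations to the joint law. -/

/-- If `W n` and `H n` are independent and `Φ n (W n, H n)` converges in distribution to `Z` for
almost every fixed value of the `H n`, then it converges in distribution to `Z`. -/
lemma tendstoInDistribution_of_ae_fixed {Ω Ω' E : Type*} [MeasurableSpace Ω] [MeasurableSpace Ω']
    [TopologicalSpace E] [MeasurableSpace E] [OpensMeasurableSpace E]
    {P : Measure Ω} [IsProbabilityMeasure P] {P' : Measure Ω'} [IsProbabilityMeasure P']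
    {α β : ℕ → Type*} [∀ n, MeasurableSpace (α n)] [∀ n, MeasurableSpace (β n)]
    {W : (n : ℕ) → Ω → α n} {H : (n : ℕ) → Ω → β n} {Φ : (n : ℕ) → β n × α n → E} {Z : Ω' → E}
    (hW : ∀ n, AEMeasurable (W n) P) (hH : ∀ n, AEMeasurable (H n) P)
    (hind : ∀ n, IndepFun (W n) (H n) P) (hΦ : ∀ n, Measurable (Φ n))
    (h : ∀ᵐ ω ∂P, TendstoInDistribution (fun n η => Φ n (H n ω, W n η)) atTop Z (fun _ => P) P') :
    TendstoInDistribution (fun n ω => Φ n (H n ω, W n ω)) atTop Z (fun _ => P) P' := by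
  obtain ⟨ω₀, hω₀⟩ := h.exists
  have hZ := hω₀.aemeasurable_limit
  have hm : ∀ n, AEMeasurable (fun ω => Φ n (H n ω, W n ω)) P := fun n =>
    (hΦ n).comp_aemeasurable ((hH n).prodMk (hW n))
  refine ⟨hm, hZ, ProbabilityMeasure.tendsto_iff_forall_integral_tendsto.2 fun f => ?_⟩
  simp only [ProbabilityMeasure.coe_mk]
  have hf : Measurable f := f.continuous.measurable
  have hmW := fun n => Measure.isProbabilityMeasure_map (hW n)
  have hmH := fun n => Measure.isProbabilityMeasure_map (hH n)
  have e : ∀ n, ∫ x, f x ∂(P.map fun ω => Φ n (H n ω, W n ω)) =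
      ∫ ω, ∫ u, f (Φ n (H n ω, u)) ∂P.map (W n) ∂P := by
    intro n
    have hfΦ : StronglyMeasurable fun p : β n × α n => f (Φ n p) :=
      (hf.comp (hΦ n)).stronglyMeasurable
    have hpair : P.map (fun ω => (H n ω, W n ω)) = (P.map (H n)).prod (P.map (W n)) :=
      (hind n).symm.map_prod_eq_prod_map_map (hH n) (hW n)
    rw [integral_map (hm n) hf.aestronglyMeasurable,
      ← integral_map (φ := fun ω => (H n ω, W n ω)) (f := fun p => f (Φ n p))
        ((hH n).prodMk (hW n)) hfΦ.aestronglyMeasurable, hpair, integral_prod]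
    · exact integral_map (hH n) hfΦ.integral_prod_right'.aestronglyMeasurable
    · exact (integrable_const ‖f‖).mono' hfΦ.aestronglyMeasurable
        (ae_of_all _ fun p => f.norm_coe_le_norm _)
  simp_rw [e]
  -- The limit is written as the integral of a constant over `Ω`, ready for dominated convergence of
  -- the inner integrals.
  have hc : ∫ x, f x ∂(P'.map Z) = ∫ _ : Ω, ∫ x, f x ∂(P'.map Z) ∂P := by simp
  rw [hc]
  refine tendsto_integral_of_dominated_convergence (fun _ => ‖f‖) (fun n => ?_)
    (integrable_const _) (fun n => ae_of_all _ fun ω => ?_) ?_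
  · have hfΦ : StronglyMeasurable fun p : β n × α n => f (Φ n p) :=
      (hf.comp (hΦ n)).stronglyMeasurable
    exact (hfΦ.integral_prod_right' (ν := P.map (W n))).aestronglyMeasurable.comp_aemeasurable (hH n)
  · refine (norm_integral_le_of_norm_le (integrable_const ‖f‖)
      (ae_of_all _ fun u => f.norm_coe_le_norm _)).trans_eq ?_
    simp
  · filter_upwards [h] with ω hω
    have := ProbabilityMeasure.tendsto_iff_forall_integral_tendsto.1 hω.tendsto f
    refine this.congr fun n => ?_
    simp only [ProbabilityMeasure.coe_mk]
    have hs : Measurable fun u => Φ n (H n ω, u) := (hΦ n).comp measurable_prodMk_left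
    refine (integral_map (hs.comp_aemeasurable (hW n)) hf.aestronglyMeasurable).trans ?_
    exact (integral_map (hW n) (hf.comp hs).aestronglyMeasurable).symm

lemma iIndepFun.map_comp_eq_pi {Ω : Type*} [MeasurableSpace Ω] {P : Measure Ω}
    [IsProbabilityMeasure P] {N : ℕ} {α : Type*} [MeasurableSpace α] {w : Fin N → Ω → α}
    (hw : ∀ i, AEMeasurable (w i) P) (hind : iIndepFun w P) {f : α → ℝ} (hf : Measurable f) :
    P.map (fun ω i => f (w i ω)) = Measure.pi fun i => (P.map (w i)).map f := by
  refine ((iIndepFun_iff_map_fun_eq_pi_map fun i => hf.comp_aemeasurable (hw i)).1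
    (hind.comp (fun _ => f) (fun _ => hf))).trans ?_
  congr 1
  funext i
  exact (AEMeasurable.map_map_of_aemeasurable hf.aemeasurable (hw i)).symm

/-- For fixed `y` the leakages of the different codewords are independent, and a product measure
depends continuously on its factors, so convergence of each marginal suffices. -/
lemma tendstoInDistribution_leakage {Ω Ω' : Type*} [MeasurableSpace Ω] [MeasurableSpace Ω']
    {P : Measure Ω} [IsProbabilityMeasure P] {P' : Measure Ω'} [IsProbabilityMeasure P']
    {K N : ℕ} (k : Fin K) {w : (n : ℕ) → Fin N → Ω → CVec (n + 1)}
    (w_iso : ∀ n i, IsIsotropicUnitVector P (w n i)) (w_indep : ∀ n, iIndepFun (w n) P)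
    {X : Fin N → Ω' → ℝ} (X_law : ∀ i, HasLaw (X i) (chiSquare (2 * (K - 1))) P')
    (X_indep : iIndepFun X P') {y : (n : ℕ) → Fin K → CVec (n + 1)} (hy : GramTendstoOne y) :
    TendstoInDistribution (fun n η (i : Fin N) => leakage k (y n) (w n i η)) atTop
      (fun ω' i => (1 / 2 : ℝ) * X i ω') (fun _ => P) P' := by
  have hwm := fun n i => (w_iso n i).aemeasurable
  have hXm := fun i => (X_law i).aemeasurable
  refine ⟨fun n => aemeasurable_pi_lambda _ fun i =>
    (measurable_leakage_right k (y n)).comp_aemeasurable (hwm n i),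
    aemeasurable_pi_lambda _ fun i => (hXm i).const_mul _, ?_⟩
  let μ : (i : Fin N) → (n : ℕ) → ProbabilityMeasure (CVec (n + 1)) := fun i n =>
    ⟨P.map (w n i), Measure.isProbabilityMeasure_map (hwm n i)⟩
  have h1 : Tendsto (fun n i => (μ i n).map (measurable_leakage_right k (y n)).aemeasurable) atTop
      (nhds fun _ : Fin N => halfChiSquare (2 * (K - 1))) :=
    tendsto_pi_nhds.2 fun i => tendsto_map_leakage k (μ := μ i)
      (fun n => (w_iso n i).isIsotropicLaw) hy
  have h2 := (ProbabilityMeasure.continuous_pi.tendsto _).comp h1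
  have hlim : ProbabilityMeasure.pi (fun _ : Fin N => halfChiSquare (2 * (K - 1))) =
      ⟨P'.map fun ω' i => (1 / 2 : ℝ) * X i ω',
        Measure.isProbabilityMeasure_map
          (aemeasurable_pi_lambda _ fun i => (hXm i).const_mul _)⟩ := by
    refine Subtype.ext (Eq.trans ?_ (iIndepFun.map_comp_eq_pi hXm X_indep
      (f := fun x => 1 / 2 * x) (by fun_prop)).symm)
    simp only [(X_law _).map_eq]
    rfl
  rw [hlim] at h2
  exact h2.congr fun n => Subtype.ext (iIndepFun.map_comp_eq_pi (hwm n) (w_indep n)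
    (measurable_leakage_right k (y n))).symm

lemma aemeasurable_quantizedChannel {Ω : Type*} [MeasurableSpace Ω] {P : Measure Ω}
    {n : ℕ} {h g : Ω → CVec n} (hh : AEMeasurable h P) (hg : AEMeasurable g P) :
    AEMeasurable (fun ω => quantizedChannel (h ω) (g ω)) P := by
  have h1 : AEMeasurable (fun ω => (‖h ω‖ : ℂ)) P :=
    Complex.measurable_ofReal.comp_aemeasurable hh.norm
  exact h1.smul hg

lemma measurable_leakage_family {n K N : ℕ} (k : Fin K) :
    Measurable fun (p : (Fin K → CVec n) × (Fin N → CVec n)) (i : Fin N) =>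
      leakage k p.1 (p.2 i) := by
  unfold leakage
  fun_prop

/-- The number of antennas is `N_t = n + 1`, `n → ∞`. First part: convergence in distribution under
the joint law of channels, channel codebooks and precoding codewords. Second part: the same for
almost every fixed realization `ω` of the quantized channels, only the (independent) precoding
codewords being random. -/
theorem mainTheorem6 {Ω Ω' : Type*} [MeasurableSpace Ω] [MeasurableSpace Ω']
    (P : Measure Ω) [IsProbabilityMeasure P] (P' : Measure Ω') [IsProbabilityMeasure P']
    (K N : ℕ) (hK : 2 ≤ K) (k : Fin K) (Bc : ℕ → ℕ)
    -- the channels `h_j`, the channel codebooks, the quantized directions, the codewords `w_i`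
    (h : (n : ℕ) → Fin K → Ω → CVec (n + 1))
    (c : (n : ℕ) → Fin K → Fin (2 ^ Bc n) → Ω → CVec (n + 1))
    (ghat : (n : ℕ) → Fin K → Ω → CVec (n + 1))
    (w : (n : ℕ) → Fin N → Ω → CVec (n + 1))
    (h_law : ∀ n j, HasLaw (h n j) (complexGaussianVec (n + 1)) P)
    (c_iso : ∀ n j a, IsIsotropicUnitVector P (c n j a))
    (hc_indep : ∀ n, iIndepFun
      (Sum.elim (h n) (fun p : Fin K × Fin (2 ^ Bc n) => c n p.1 p.2)) P)
    (ghat_meas : ∀ n j, AEMeasurable (ghat n j) P)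
    (ghat_argmax : ∀ n j, ∀ᵐ ω ∂P,
      IsQuantizedDirection (h n j ω) (fun a => c n j a ω) (ghat n j ω))
    (w_iso : ∀ n i, IsIsotropicUnitVector P (w n i))
    (w_indep : ∀ n, iIndepFun (w n) P)
    (w_indep_hhat : ∀ n, IndepFun (fun ω i => w n i ω)
      (fun ω j => quantizedChannel (h n j ω) (ghat n j ω)) P)
    (X : Fin N → Ω' → ℝ)
    (X_law : ∀ i, HasLaw (X i) (chiSquare (2 * (K - 1))) P')
    (X_indep : iIndepFun X P') :
    TendstoInDistribution
      (fun n ω (i : Fin N) =>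
        leakage k (fun j => quantizedChannel (h n j ω) (ghat n j ω)) (w n i ω))
      atTop (fun ω' i => (1 / 2 : ℝ) * X i ω') (fun _ => P) P' ∧
    ∀ᵐ ω ∂P, TendstoInDistribution
      (fun n η (i : Fin N) =>
        leakage k (fun j => quantizedChannel (h n j ω) (ghat n j ω)) (w n i η))
      atTop (fun ω' i => (1 / 2 : ℝ) * X i ω') (fun _ => P) P' := by
  have hfixed : ∀ᵐ ω ∂P, TendstoInDistribution
      (fun n η (i : Fin N) =>
        leakage k (fun j => quantizedChannel (h n j ω) (ghat n j ω)) (w n i η))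
      atTop (fun ω' i => (1 / 2 : ℝ) * X i ω') (fun _ => P) P' := by
    filter_upwards [ae_gramTendstoOne_quantizedChannel (M := fun n => 2 ^ Bc n) h_law c_iso
      hc_indep ghat_meas ghat_argmax] with ω hω
    exact tendstoInDistribution_leakage k w_iso w_indep X_law X_indep hω
  refine ⟨?_, hfixed⟩
  exact tendstoInDistribution_of_ae_fixed (α := fun n => Fin N → CVec (n + 1))
    (β := fun n => Fin K → CVec (n + 1))
    (fun n => aemeasurable_pi_lambda _ fun i => (w_iso n i).aemeasurable)
    (fun n => aemeasurable_pi_lambda _ fun j =>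
      aemeasurable_quantizedChannel (h_law n j).aemeasurable (ghat_meas n j))
    w_indep_hhat (fun n => measurable_leakage_family k) hfixed
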